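/- **Setting.** Work in adapted local coordinates: $Q\subset\mathbb R^n$ is open, with a $C^1$ Riemannian metric $\mathrm g_Q$; $\rho(q):\mathbb R^m\to\mathbb R^n$ $(q\in Q)$ is linear, injective and $C^1$ in $q$; $\mathrm g=\rho^{\top}\mathrm g_Q\,\rho$; $b=\rho\,\mathrm g^{-1}\rho^{\top}$; $f:Q\times\mathbb R^n\to\mathbb R^n$ is $C^2$ and $\phi:Q\times\mathbb R^n\to\mathbb R$ is $C^1$. Fix $(q^0,\dot q^0)$, $T>0$, $N\ge 2$, $h=T/N$, $t_k=kh$. Write $y=(q,\lambda)\in Q\times\mathbb R^n$. **Continuous optimality.** $(y,\mu,\nu)$ is *optimal* if $q\in C^3([0,T],Q)$, $\lambda\in C^2([0,T],\mathbb R^n)$ and there is $u\in C^1([0,T],\mathbb R^m)$ such that on $[0,T]$ $$\ddot\lambda=\big(\partial_q f+\partial_q\rho(q)u\big)^{\top}\lambda-\tfrac{d}{dt}\big((\partial_{\dot q}f)^{\top}\lambda\big)-\tfrac12\big(\partial_q\mathrm g(q)(u,u)\big)^{\top},\qquad \ddot q=f(q,\dot q)+\rho(q)u,\qquad \mathrm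 g(q)u=\rho(q)^{\top}\lambda,$$ together with $q(0)=q^0$, $\dot q(0)=\dot q^0$ and the transversality conditions $$\mu=-\dot\lambda(0)-(\partial_{\dot q}f)^{\top}\lambda(0),\quad \nu=\lambda(0),\quad \dot\lambda(T)=(\partial_q\phi)^{\top}+(\partial_{\dot q}f)^{\top}(\partial_{\dot q}\phi)^{\top},\quad \lambda(T)=-(\partial_{\dot q}\phi)^{\top},$$ where $f$ and $\phi$ are evaluated at $(q(0),\dot q(0))$, respectively $(q(T),\dot q(T))$. **Exact discrete Lagrangian.** Let $\tilde{\mathcal L}(q,\lambda,v,v_\lambda)=v_\lambda^{\top}v+\lambda^{\top}f(q,v)+\frac12\lambda^{\top}b(q)\lambda$, with Euler–Lagrange equations $$\ddot\lambda=\tfrac12\big(\partial_q b(q)(\lambda,\lambda)\big)^{\top}+(\partial_q f)^{\top}\lambda-\tfrac{d}{dt}\big((\partial_{\dot q}f)^{\top}\lambda\big),\qquad \ddot q=f(q,\dot q)+b(q)\lambda .$$ Solutions are sought with $q\in C^3$, $\lambda\in C^2$. Since the two-point boundary value problem is in general only locally uniquely solvable, fix a set $W$ of pairs (position $y$, velocity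 $\dot y$), possibly all of them, and let $y_{a,b}:[0,h]\to Q\times\mathbb R^n$ be the solution with $y_{a,b}(0)=a$, $y_{a,b}(h)=b$ and $(y_{a,b},\dot y_{a,b})\in W$ on $[0,h]$. Put $\tilde{\mathcal L}^e_d(a,b)=\int_0^h\tilde{\mathcal L}(y_{a,b},\dot y_{a,b})\,dt$. The pair $(a,b)$ is *in the domain of* $\tilde{\mathcal L}^e_d$ if on a neighbourhood of $(a,b)$ this solution exists, is unique, and depends, with its velocity, $C^1$ on the endpoints and on $t\in[0,h]$ jointly. Put $v_0^{e,-}=-D_{\lambda_0}\tilde{\mathcal L}^e_d(y_0,y_1)$, $v_N^{e,+}=D_{\lambda_N}\tilde{\mathcal L}^e_d(y_{N-1},y_N)$, $\tilde{\mathcal L}^e_{d,k}=\tilde{\mathcal L}^e_d(y_k,y_{k+1})$ and $$\tilde{\mathcal J}^e_d[y_d,\mu,\nu]=\phi(q_N,v_N^{e,+})+\mu^{\top}(q_0-q^0)+\nu^{\top}(v_0^{e,-}-\dot q^0)+\lambda_N^{\top}v_N^{e,+}-\lambda_0^{\top}v_0^{e,-}-\sum_{k=0}^{N-1}\tilde{\mathcal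 L}^e_{d,k}.$$ Below, all consecutive pairs $(y_k,y_{k+1})$ of a discrete curve $y_d=(y_0,\dots,y_N)$ are assumed to be in the domain of $\tilde{\mathcal L}^e_d$. **Discrete optimality conditions.** With $\phi$ evaluated at $(q_N,v_N^{e,+})$, and with $[\,\cdot\,]$ equal to $1$ if the enclosed statement holds and to $0$ otherwise: * $\delta q_0$: $(\nu-\lambda_0)^{\top}D_{q_0}v_0^{e,-}+\mu^{\top}-D_{q_0}\tilde{\mathcal L}^e_{d,0}=0$; * $\delta\lambda_0$: $(\nu-\lambda_0)^{\top}D_{\lambda_0}v_0^{e,-}-(v_0^{e,-})^{\top}-D_{\lambda_0}\tilde{\mathcal L}^e_{d,0}=0$; * $\delta y_k$, $1\le k\le N-1$: $[k=1]\,(\nu-\lambda_0)^{\top}D_2v_0^{e,-}+[k=N-1]\,(D_2\phi+\lambda_N^{\top})D_1v_N^{e,+}-(D_2\tilde{\mathcal L}^e_{d,k-1}+D_1\tilde{\mathcal L}^e_{d,k})=0$; * $\delta q_N$: $(D_2\phi+\lambda_N^{\top})D_{q_N}v_N^{e,+}+D_1\phi-D_{q_N}\tilde{\mathcal L}^e_{d,N-1}=0$;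 * $\delta\lambda_N$: $(D_2\phi+\lambda_N^{\top})D_{\lambda_N}v_N^{e,+}+(v_N^{e,+})^{\top}-D_{\lambda_N}\tilde{\mathcal L}^e_{d,N-1}=0$; * $\delta\mu$, $\delta\nu$: $q_0=q^0$ and $v_0^{e,-}=\dot q^0$. Consider two versions of the discrete system: **(H1)** the full list, under the assumption that $D_{\lambda_0}v_0^{e,-}$ and $D_{\lambda_N}v_N^{e,+}$ have full rank at $y_d$; **(H2)** the list in which the $\delta\lambda_0$ and $\delta\lambda_N$ conditions are replaced by $\nu=\lambda_0$ and $\lambda_N=-(D_2\phi)^{\top}$. **Theorem.** The full list is equivalent to the stationarity (vanishing derivative) of $\tilde{\mathcal J}^e_d$ at $(y_d,\mu,\nu)$. Moreover, under either (H1) or (H2) the discrete and the continuous optimality conditions are equivalent in the following sense. 1. If $(y,\mu,\nu)$ is optimal, $(y,\dot y)\in W$ on $[0,T]$ and the pairs $(y(t_k),y(t_{k+1}))$ are in the domain of $\tilde{\mathcal L}^e_d$, then $(y_d,\mu,\nu)$ with $y_k=y(t_k)$ solves the discrete system. (It solves the full list and the list of (H2), without any rank assumption.) 2. If $(y_d,\mu,\nu)$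 solves the discrete system in version (H1) or in version (H2), then $(y,\mu,\nu)$ is optimal, where $y(t)=y_{k,k+1}(t-t_k)$ for $t\in[t_k,t_{k+1}]$, $k=0,\dots,N-1$, and $y_{k,k+1}=y_{a,b}$ with $a=y_k$, $b=y_{k+1}$. -/

import Mathlib

noncomputable section

/-- Coordinate space `ℝⁿ`. Covectors are identified with vectors through `λᵀ v = inner ℝ λ v`. -/
abbrev Coord (n : ℕ) : Type := EuclideanSpace ℝ (Fin n)

/-- Points `y = (q, λ)` of `T*Q` in coordinates. -/
abbrev Phase (n : ℕ) : Type := Coord n × Coord n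

/-- Data of the optimal control problem in adapted local coordinates:
minimise `φ(q(T), q'(T)) + ∫ ½ uᵀ g(q) u` subject to `q'' = f(q, q') + ρ(q) u`,
with configuration domain `Q` open in `ℝⁿ`, controls in `ℝᵐ`, a Riemannian metric `gQ` on `Q`
and an injective anchor `ρ`; the metric `g` on controls is the pullback `ρ* gQ`, see
`ControlProblem.g`. -/
structure ControlProblem (n m : ℕ) where
  Q : Set (Coord n)
  isOpen_Q : IsOpen Q
  gQ : Coord n → (Coord n →L[ℝ] Coord n)
  gQ_symm : ∀ q ∈ Q, ∀ v w : Coord n, inner ℝ (gQ q v) w = inner ℝ v (gQ q w)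
  gQ_pos : ∀ q ∈ Q, ∀ v : Coord n, v ≠ 0 → 0 < inner ℝ v (gQ q v)
  gQ_contDiffOn : ContDiffOn ℝ 1 gQ Q
  ρ : Coord n → (Coord m →L[ℝ] Coord n)
  ρ_injective : ∀ q ∈ Q, Function.Injective (ρ q)
  ρ_contDiffOn : ContDiffOn ℝ 1 ρ Q
  f : Coord n → Coord n → Coord n
  f_contDiffOn : ContDiffOn ℝ 2 (fun z : Coord n × Coord n => f z.1 z.2) (Q ×ˢ Set.univ)
  φ : Coord n → Coord n → ℝ
  φ_contDiffOn : ContDiffOn ℝ 1 (fun z : Coord n × Coord n => φ z.1 z.2) (Q ×ˢ Set.univ)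

namespace ControlProblem

variable {n m : ℕ} (P : ControlProblem n m)

/-- The metric on the control bundle, `g = ρᵀ gQ ρ`. -/
def g (q : Coord n) : Coord m →L[ℝ] Coord m :=
  (ContinuousLinearMap.adjoint (P.ρ q)).comp ((P.gQ q).comp (P.ρ q))

/-- `b = ρ g⁻¹ ρᵀ`. -/
def b (q : Coord n) : Coord n →L[ℝ] Coord n :=
  (P.ρ q).comp ((P.g q).inverse.comp (ContinuousLinearMap.adjoint (P.ρ q)))

/-- `(∂f/∂q)ᵀ` at `(q, v)`. -/
def dfqT (q v : Coord n) : Coord n →L[ℝ] Coord n :=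
  ContinuousLinearMap.adjoint (fderiv ℝ (fun q' => P.f q' v) q)

/-- `(∂f/∂q')ᵀ` (transposed derivative in the velocity) at `(q, v)`. -/
def dfvT (q v : Coord n) : Coord n →L[ℝ] Coord n :=
  ContinuousLinearMap.adjoint (fderiv ℝ (fun v' => P.f q v') v)

/-- `(∂φ/∂q)ᵀ`. -/
def gradPhiQ (q v : Coord n) : Coord n := gradient (fun q' => P.φ q' v) q

/-- `(∂φ/∂q')ᵀ`. -/
def gradPhiV (q v : Coord n) : Coord n := gradient (fun v' => P.φ q v') v

/-! ### Continuous optimality conditions -/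

/-- The triple `(y, μ, ν)`, `y = (q, λ)`, with the control `u`, satisfies on `[0, T]` the continuous
first-order optimality conditions. All time derivatives are relative to `[0, T]`. -/
structure IsContinuousOptimal (T : ℝ) (q0 v0 : Coord n) (y : ℝ → Phase n) (u : ℝ → Coord m)
    (μ ν : Coord n) : Prop where
  contDiff_q : ContDiffOn ℝ 3 (fun t => (y t).1) (Set.Icc 0 T)
  contDiff_l : ContDiffOn ℝ 2 (fun t => (y t).2) (Set.Icc 0 T)
  contDiff_u : ContDiffOn ℝ 1 u (Set.Icc 0 T)
  mem_Q : ∀ t ∈ Set.Icc 0 T, (y t).1 ∈ P.Q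
  adjoint_dynamics : ∀ t ∈ Set.Icc 0 T,
    derivWithin (derivWithin (fun s => (y s).2) (Set.Icc 0 T)) (Set.Icc 0 T) t =
      P.dfqT (y t).1 (derivWithin (fun s => (y s).1) (Set.Icc 0 T) t) (y t).2
      + ContinuousLinearMap.adjoint (fderiv ℝ (fun q' => P.ρ q' (u t)) (y t).1) (y t).2
      - derivWithin (fun s =>
          P.dfvT (y s).1 (derivWithin (fun r => (y r).1) (Set.Icc 0 T) s) (y s).2)
          (Set.Icc 0 T) t
      - (1 / 2 : ℝ) • gradient (fun q' => (inner ℝ (u t) (P.g q' (u t)) : ℝ)) (y t).1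
  state_dynamics : ∀ t ∈ Set.Icc 0 T,
    derivWithin (derivWithin (fun s => (y s).1) (Set.Icc 0 T)) (Set.Icc 0 T) t =
      P.f (y t).1 (derivWithin (fun s => (y s).1) (Set.Icc 0 T) t) + P.ρ (y t).1 (u t)
  minimisation : ∀ t ∈ Set.Icc 0 T,
    P.g (y t).1 (u t) = ContinuousLinearMap.adjoint (P.ρ (y t).1) (y t).2
  initial_q : (y 0).1 = q0
  initial_v : derivWithin (fun s => (y s).1) (Set.Icc 0 T) 0 = v0
  transversality_mu : μ = -derivWithin (fun s => (y s).2) (Set.Icc 0 T) 0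
    - P.dfvT (y 0).1 (derivWithin (fun s => (y s).1) (Set.Icc 0 T) 0) (y 0).2
  transversality_nu : ν = (y 0).2
  transversality_dl : derivWithin (fun s => (y s).2) (Set.Icc 0 T) T =
    P.gradPhiQ (y T).1 (derivWithin (fun s => (y s).1) (Set.Icc 0 T) T)
    + P.dfvT (y T).1 (derivWithin (fun s => (y s).1) (Set.Icc 0 T) T)
        (P.gradPhiV (y T).1 (derivWithin (fun s => (y s).1) (Set.Icc 0 T) T))
  transversality_l : (y T).2 =
    -P.gradPhiV (y T).1 (derivWithin (fun s => (y s).1) (Set.Icc 0 T) T)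

/-! ### The new Lagrangian and its exact discrete Lagrangian -/

/-- The control-independent Lagrangian `v_λᵀ v + λᵀ f(q, v) + ½ λᵀ b(q) λ` at the point
`y = (q, λ)` with velocity `w = (v, v_λ)`. -/
def lagrangian (y w : Phase n) : ℝ :=
  inner ℝ w.2 w.1 + inner ℝ y.2 (P.f y.1 w.1) + (1 / 2 : ℝ) * inner ℝ y.2 (P.b y.1 y.2)

/-- `c` solves on `[0, h]` the Euler-Lagrange equations of `lagrangian`. -/
structure IsELSolution (h : ℝ) (c : ℝ → Phase n) : Prop where
  contDiff_q : ContDiffOn ℝ 3 (fun t => (c t).1) (Set.Icc 0 h)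
  contDiff_l : ContDiffOn ℝ 2 (fun t => (c t).2) (Set.Icc 0 h)
  mem_Q : ∀ t ∈ Set.Icc 0 h, (c t).1 ∈ P.Q
  adjoint_dynamics : ∀ t ∈ Set.Icc 0 h,
    derivWithin (derivWithin (fun s => (c s).2) (Set.Icc 0 h)) (Set.Icc 0 h) t =
      (1 / 2 : ℝ) • gradient (fun q' => (inner ℝ (c t).2 (P.b q' (c t).2) : ℝ)) (c t).1
      + P.dfqT (c t).1 (derivWithin (fun s => (c s).1) (Set.Icc 0 h) t) (c t).2
      - derivWithin (fun s =>
          P.dfvT (c s).1 (derivWithin (fun r => (c r).1) (Set.Icc 0 h) s) (c s).2)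
          (Set.Icc 0 h) t
  state_dynamics : ∀ t ∈ Set.Icc 0 h,
    derivWithin (derivWithin (fun s => (c s).1) (Set.Icc 0 h)) (Set.Icc 0 h) t =
      P.f (c t).1 (derivWithin (fun s => (c s).1) (Set.Icc 0 h) t) + P.b (c t).1 (c t).2

/-- `c` is an Euler-Lagrange solution on `[0, h]` from `y₀` to `y₁`, and `(c, c')` stays in `W`.
The solution of the two-point boundary value problem is in general only locally unique; the set
`W` of positions and velocities is the region in which it is looked for (`W = univ` imposes no
restriction). -/
structure IsExactSegment (W : Set (Phase n × Phase n)) (h : ℝ) (y₀ y₁ : Phase n)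
    (c : ℝ → Phase n) : Prop where
  solves : P.IsELSolution h c
  left : c 0 = y₀
  right : c h = y₁
  mem_W : ∀ t ∈ Set.Icc 0 h, (c t, derivWithin c (Set.Icc 0 h) t) ∈ W

open Classical in
/-- The solution segment `y_{k,k+1}` from `y₀` to `y₁` in time `h` (zero if there is none). -/
def segment (W : Set (Phase n × Phase n)) (h : ℝ) (y₀ y₁ : Phase n) : ℝ → Phase n :=
  if H : ∃ c, P.IsExactSegment W h y₀ y₁ c then H.choose else fun _ => 0

/-- The exact discrete Lagrangian: the action of the solution segment. -/
def exactLd (W : Set (Phase n × Phase n)) (h : ℝ) (y₀ y₁ : Phase n) : ℝ :=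
  ∫ t in (0 : ℝ)..h,
    P.lagrangian (P.segment W h y₀ y₁ t) (derivWithin (P.segment W h y₀ y₁) (Set.Icc 0 h) t)

/-- `(y₀, y₁)` belongs to the domain of the exact discrete Lagrangian: for all endpoints near
`(y₀, y₁)` the solution segment exists and is unique, and this segment and its velocity depend
continuously differentiably on the endpoints and on time. -/
def InExactDomain (W : Set (Phase n × Phase n)) (h : ℝ) (y₀ y₁ : Phase n) : Prop :=
  ∃ U : Set (Phase n × Phase n), IsOpen U ∧ (y₀, y₁) ∈ U ∧
    (∀ p ∈ U, ∃ c, P.IsExactSegment W h p.1 p.2 c ∧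
      ∀ c', P.IsExactSegment W h p.1 p.2 c' → Set.EqOn c' c (Set.Icc 0 h)) ∧
    ContDiffOn ℝ 1
      (fun z : (Phase n × Phase n) × ℝ =>
        (P.segment W h z.1.1 z.1.2 z.2,
          derivWithin (P.segment W h z.1.1 z.1.2) (Set.Icc 0 h) z.2))
      (U ×ˢ Set.Icc 0 h)

/-- Discrete velocity `v₀^{e,-}(y₀, y₁) = -D_{λ₀} L_d(y₀, y₁)`. -/
def vMinus (W : Set (Phase n × Phase n)) (h : ℝ) (y₀ y₁ : Phase n) : Coord n :=
  -gradient (fun l => P.exactLd W h (y₀.1, l) y₁) y₀.2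

/-- Discrete velocity `v₁^{e,+}(y₀, y₁) = D_{λ₁} L_d(y₀, y₁)`. -/
def vPlus (W : Set (Phase n × Phase n)) (h : ℝ) (y₀ y₁ : Phase n) : Coord n :=
  gradient (fun l => P.exactLd W h y₀ (y₁.1, l)) y₁.2

/-! ### Discrete curves, the discrete objective and its stationarity conditions -/

/-- The `k`-th node `y_k` (`0 ≤ k ≤ N`) of a discrete curve `(y_0, …, y_N)`. -/
def node {N : ℕ} (yd : Fin (N + 1) → Phase n) (k : ℕ) : Phase n := yd (Fin.ofNat (N + 1) k)

/-- All consecutive pairs of nodes lie in the domain of the exact discrete Lagrangian. -/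
def NodesInExactDomain (W : Set (Phase n × Phase n)) (h : ℝ) {N : ℕ}
    (yd : Fin (N + 1) → Phase n) : Prop :=
  ∀ k < N, P.InExactDomain W h (node yd k) (node yd (k + 1))

/-- The exact discrete control-independent augmented objective. -/
def discreteObjective (W : Set (Phase n × Phase n)) (h : ℝ) (q0 v0 : Coord n) {N : ℕ}
    (yd : Fin (N + 1) → Phase n) (μ ν : Coord n) : ℝ :=
  P.φ (node yd N).1 (P.vPlus W h (node yd (N - 1)) (node yd N))
  + inner ℝ μ ((node yd 0).1 - q0)
  + inner ℝ ν (P.vMinus W h (node yd 0) (node yd 1) - v0)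
  + inner ℝ (node yd N).2 (P.vPlus W h (node yd (N - 1)) (node yd N))
  - inner ℝ (node yd 0).2 (P.vMinus W h (node yd 0) (node yd 1))
  - ∑ k ∈ Finset.range N, P.exactLd W h (node yd k) (node yd (k + 1))

/-- The covector `D₂φ + λ_Nᵀ`, with `D₂φ` taken at `(q_N, v_N^{e,+})`. -/
def endCovector (W : Set (Phase n × Phase n)) (h : ℝ) {N : ℕ}
    (yd : Fin (N + 1) → Phase n) : Coord n →L[ℝ] ℝ :=
  fderiv ℝ (fun v => P.φ (node yd N).1 v) (P.vPlus W h (node yd (N - 1)) (node yd N))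
    + innerSL ℝ (node yd N).2

/-- The partial derivative `D_{λ₀} v₀^{e,-}` at `(y₀, y₁)`. -/
def dVMinus (W : Set (Phase n × Phase n)) (h : ℝ) {N : ℕ}
    (yd : Fin (N + 1) → Phase n) : Coord n →L[ℝ] Coord n :=
  fderiv ℝ (fun l => P.vMinus W h ((node yd 0).1, l) (node yd 1)) (node yd 0).2

/-- The partial derivative `D_{λ_N} v_N^{e,+}` at `(y_{N-1}, y_N)`. -/
def dVPlus (W : Set (Phase n × Phase n)) (h : ℝ) {N : ℕ}
    (yd : Fin (N + 1) → Phase n) : Coord n →L[ℝ] Coord n :=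
  fderiv ℝ (fun l => P.vPlus W h (node yd (N - 1)) ((node yd N).1, l)) (node yd N).2

/-- The hypothesis that `D_{λ₀} v₀^{e,-}` and `D_{λ_N} v_N^{e,+}` have full rank. -/
def FullRank (W : Set (Phase n × Phase n)) (h : ℝ) {N : ℕ}
    (yd : Fin (N + 1) → Phase n) : Prop :=
  (P.dVMinus W h yd : Coord n →ₗ[ℝ] Coord n).rank = n ∧
    (P.dVPlus W h yd : Coord n →ₗ[ℝ] Coord n).rank = n

/-- The discrete optimality conditions other than those for `δλ₀` and `δλ_N`. -/
structure DiscreteConditions (W : Set (Phase n × Phase n)) (h : ℝ) (q0 v0 : Coord n) {N : ℕ}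
    (yd : Fin (N + 1) → Phase n) (μ ν : Coord n) : Prop where
  /-- `δq₀` -/
  delta_q_zero :
    (innerSL ℝ (ν - (node yd 0).2)).comp
        (fderiv ℝ (fun q => P.vMinus W h (q, (node yd 0).2) (node yd 1)) (node yd 0).1)
      + innerSL ℝ μ
      - fderiv ℝ (fun q => P.exactLd W h (q, (node yd 0).2) (node yd 1)) (node yd 0).1 = 0
  /-- `δy_k`, `1 ≤ k ≤ N - 1`: for `1 < k < N - 1` these are the discrete Euler-Lagrange equations;
  the term with `v₀^{e,-}` enters for `k = 1`, the term with `v_N^{e,+}` for `k = N - 1`. -/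
  delta_y : ∀ k, 1 ≤ k → k ≤ N - 1 →
    (if k = 1 then (innerSL ℝ (ν - (node yd 0).2)).comp
        (fderiv ℝ (fun z => P.vMinus W h (node yd 0) z) (node yd 1)) else 0)
      + (if k = N - 1 then (P.endCovector W h yd).comp
        (fderiv ℝ (fun z => P.vPlus W h z (node yd N)) (node yd (N - 1))) else 0)
      - (fderiv ℝ (fun z => P.exactLd W h (node yd (k - 1)) z) (node yd k)
        + fderiv ℝ (fun z => P.exactLd W h z (node yd (k + 1))) (node yd k)) = 0
  /-- `δq_N` -/
  delta_q_last :
    (P.endCovector W h yd).comp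
        (fderiv ℝ (fun q => P.vPlus W h (node yd (N - 1)) (q, (node yd N).2)) (node yd N).1)
      + fderiv ℝ (fun q => P.φ q (P.vPlus W h (node yd (N - 1)) (node yd N))) (node yd N).1
      - fderiv ℝ (fun q => P.exactLd W h (node yd (N - 1)) (q, (node yd N).2)) (node yd N).1 = 0
  /-- `δμ` -/
  delta_mu : (node yd 0).1 = q0
  /-- `δν` -/
  delta_nu : P.vMinus W h (node yd 0) (node yd 1) = v0

/-- The full list of discrete optimality conditions. -/
structure IsDiscreteOptimal (W : Set (Phase n × Phase n)) (h : ℝ) (q0 v0 : Coord n) {N : ℕ}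
    (yd : Fin (N + 1) → Phase n) (μ ν : Coord n) : Prop
    extends P.DiscreteConditions W h q0 v0 yd μ ν where
  /-- `δλ₀` -/
  delta_l_zero :
    (innerSL ℝ (ν - (node yd 0).2)).comp (P.dVMinus W h yd)
      - innerSL ℝ (P.vMinus W h (node yd 0) (node yd 1))
      - fderiv ℝ (fun l => P.exactLd W h ((node yd 0).1, l) (node yd 1)) (node yd 0).2 = 0
  /-- `δλ_N` -/
  delta_l_last :
    (P.endCovector W h yd).comp (P.dVPlus W h yd)
      + innerSL ℝ (P.vPlus W h (node yd (N - 1)) (node yd N))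
      - fderiv ℝ (fun l => P.exactLd W h (node yd (N - 1)) ((node yd N).1, l)) (node yd N).2 = 0

/-- The discrete optimality conditions with those for `δλ₀` and `δλ_N` replaced by the
transversality conditions `ν = λ₀` and `λ_N = -(∂φ/∂q')ᵀ`. -/
structure IsDiscreteOptimalSubst (W : Set (Phase n × Phase n)) (h : ℝ) (q0 v0 : Coord n) {N : ℕ}
    (yd : Fin (N + 1) → Phase n) (μ ν : Coord n) : Prop
    extends P.DiscreteConditions W h q0 v0 yd μ ν where
  subst_zero : ν = (node yd 0).2
  subst_last : (node yd N).2 =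
    -P.gradPhiV (node yd N).1 (P.vPlus W h (node yd (N - 1)) (node yd N))

/-- The sampling `y_k = y(k h)`, `k = 0, …, N`. -/
def sample (h : ℝ) (N : ℕ) (y : ℝ → Phase n) : Fin (N + 1) → Phase n :=
  fun k => y (((k : ℕ) : ℝ) * h)

/-- The piecewise curve equal to `t ↦ y_{k,k+1}(t - k h)` on `[k h, (k + 1) h]`. -/
def glue (W : Set (Phase n × Phase n)) (h : ℝ) {N : ℕ} (yd : Fin (N + 1) → Phase n) :
    ℝ → Phase n :=
  fun t => P.segment W h (node yd (min ⌊t / h⌋₊ (N - 1))) (node yd (min ⌊t / h⌋₊ (N - 1) + 1))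
    (t - ((min ⌊t / h⌋₊ (N - 1) : ℕ) : ℝ) * h)

end ControlProblem

end

/-! The exact discrete Lagrangian is a generating function of the Euler-Lagrange flow of L̃. The
momenta of L̃ are ∂L̃/∂q̇ = p := λ̇ + (∂f/∂q̇)ᵀλ, conjugate to q, and ∂L̃/∂λ̇ = q̇, conjugate to λ.
Differentiating the action along solutions and integrating by parts leaves only boundary terms, so
the derivative of L_d at (y₀, y₁) is (p, q̇) at time h paired with δy₁ minus (p, q̇) at time 0
paired with δy₀ (`InExactDomain.hasFDerivAt_exactLd`). In particular v₀^{e,-} and v_N^{e,+} are the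
true velocities at the two ends, and a discrete Euler-Lagrange equation says that p and q̇ are
continuous across a node.

On the continuous side, g u = ρᵀλ determines u, and an envelope identity (`half_gradient_b`) turns
the remaining equations into the Euler-Lagrange equations of L̃. Once λ(T) = -(∂φ/∂q̇)ᵀ is used, the
transversality conditions on λ̇ read μ = -p(0) and p(T) = (∂φ/∂q)ᵀ.

The δλ conditions are where (H1) and (H2) differ: by the definition of v^∓ their last two terms
cancel, leaving (ν - λ₀)ᵀ D_{λ₀}v₀^{e,-} = 0 and its analogue at N. Full rank gives the
transversality conditions of (H2), and these conversely make both products zero. Under them every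
derivative of v^∓ drops out, and the discrete system becomes matching at inner nodes plus boundary
conditions (`isDiscreteOptimalSubst_iff`).

A sampled optimal curve satisfies these because, by uniqueness, the segments are its restrictions.
Conversely, matched segments glue to a solution of the first-order system for (q, λ, q̇, p)
(`IsELFlow`): its right sides depend on the state alone, so one-sided derivatives agree at the
nodes, and C³ and C² regularity follows from the equations. -/

noncomputable section

open Set

/-! ### Calculus on closed intervals: parameter integrals, primitives, gluing of derivatives. -/

/-- At an endpoint t of a closed time interval only a derivative within the product is available;
the slice in z lies in an open set, so in that direction it is a full derivative. -/
theorem HasFDerivWithinAt.hasFDerivAt_partial_left {Z E : Type*} [NormedAddCommGroup Z]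
    [NormedSpace ℝ Z] [NormedAddCommGroup E] [NormedSpace ℝ E] {U : Set Z} {S : Set ℝ}
    (hU : IsOpen U) {G : Z × ℝ → E} {G' : Z × ℝ →L[ℝ] E} {z : Z} (hz : z ∈ U) {t : ℝ} (ht : t ∈ S)
    (hG : HasFDerivWithinAt G G' (U ×ˢ S) (z, t)) :
    HasFDerivAt (fun x => G (x, t)) (G'.comp (ContinuousLinearMap.inl ℝ Z ℝ)) z := by
  have h1 : HasFDerivWithinAt (fun x : Z => (x, t)) (ContinuousLinearMap.inl ℝ Z ℝ) U z :=
    (hasFDerivAt_prodMk_left z t).hasFDerivWithinAt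
  have h2 := hG.comp z h1 (fun x (hx : x ∈ U) => (⟨hx, ht⟩ : (x, t) ∈ U ×ˢ S))
  exact h2.hasFDerivAt (hU.mem_nhds hz)

/-- A jointly `C¹` family of curves on `[a, b]` has a continuous derivative in the parameter, and
its primitives may be differentiated under the integral sign. -/
theorem ContDiffOn.exists_partial_deriv_integral {Z E : Type*} [NormedAddCommGroup Z]
    [NormedSpace ℝ Z] [FiniteDimensional ℝ Z] [NormedAddCommGroup E] [NormedSpace ℝ E]
    {U : Set Z} (hU : IsOpen U) {a b : ℝ} (hab : a < b) {G : Z × ℝ → E}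
    (hG : ContDiffOn ℝ 1 G (U ×ˢ Icc a b)) :
    ∃ D : Z × ℝ → Z →L[ℝ] E, ContinuousOn D (U ×ˢ Icc a b) ∧
      (∀ z ∈ U, ∀ t ∈ Icc a b, HasFDerivAt (fun x => G (x, t)) (D (z, t)) z) ∧
      ∀ z ∈ U, ∀ t ∈ Icc a b,
        HasFDerivAt (fun x => ∫ s in a..t, G (x, s)) (∫ s in a..t, D (z, s)) z := by
  have : ProperSpace Z := FiniteDimensional.proper ℝ Z
  have hu : UniqueDiffOn ℝ (U ×ˢ Icc a b) := hU.uniqueDiffOn.prod (uniqueDiffOn_Icc hab)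
  refine ⟨fun p => (fderivWithin ℝ G (U ×ˢ Icc a b) p).comp (ContinuousLinearMap.inl ℝ Z ℝ),
    ?_, ?_, ?_⟩
  · exact (hG.continuousOn_fderivWithin hu le_rfl).clm_comp continuousOn_const
  · intro z hz t ht
    exact ((hG.differentiableOn one_ne_zero _ ⟨hz, ht⟩).hasFDerivWithinAt).hasFDerivAt_partial_left
      hU hz ht
  · intro z hz t ht
    have hD : ContinuousOn (fun p => (fderivWithin ℝ G (U ×ˢ Icc a b) p).comp
        (ContinuousLinearMap.inl ℝ Z ℝ)) (U ×ˢ Icc a b) :=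
      (hG.continuousOn_fderivWithin hu le_rfl).clm_comp continuousOn_const
    -- On a compact ball around z times [a, b] the continuous partial derivative is bounded; the
    -- bound C is the dominating function.
    obtain ⟨r, hr, hrU⟩ := Metric.nhds_basis_closedBall.mem_iff.1 (hU.mem_nhds hz)
    have hsub : Metric.closedBall z r ×ˢ Icc a b ⊆ U ×ˢ Icc a b := prod_mono hrU subset_rfl
    obtain ⟨C, hC⟩ := ((isCompact_closedBall z r).prod isCompact_Icc).exists_bound_of_continuousOn
      (hD.mono hsub)
    have hIoc : uIoc a t ⊆ Icc a b := by
      rw [uIoc_of_le ht.1]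
      exact Ioc_subset_Icc_self.trans (Icc_subset_Icc le_rfl ht.2)
    have huIcc : uIcc a t ⊆ Icc a b := by
      rw [uIcc_of_le ht.1]
      exact Icc_subset_Icc le_rfl ht.2
    have slice : ∀ x ∈ U, ContinuousOn (fun s : ℝ => (x, s)) (Icc a b) := fun x _ => by fun_prop
    refine intervalIntegral.hasFDerivAt_integral_of_dominated_of_fderiv_le
      (F' := fun x s => (fderivWithin ℝ G (U ×ˢ Icc a b) (x, s)).comp
        (ContinuousLinearMap.inl ℝ Z ℝ)) (bound := fun _ => C)
      (Metric.closedBall_mem_nhds z hr) ?_ ?_ ?_ ?_ intervalIntegrable_const ?_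
    · filter_upwards [hU.mem_nhds hz] with x hx
      exact ((hG.continuousOn.comp (slice x hx) (fun s hs => ⟨hx, hs⟩)).mono
        hIoc).aestronglyMeasurable measurableSet_uIoc
    · exact ((hG.continuousOn.comp (slice z hz) (fun s hs => ⟨hz, hs⟩)).mono
        huIcc).intervalIntegrable
    · exact ((hD.comp (slice z hz) (fun s hs => ⟨hz, hs⟩)).mono
        hIoc).aestronglyMeasurable measurableSet_uIoc
    · exact Filter.Eventually.of_forall fun s hs x hx => hC (x, s) ⟨hx, hIoc hs⟩
    · refine Filter.Eventually.of_forall fun s hs x hx => ?_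
      exact ((hG.differentiableOn one_ne_zero _
        ⟨hrU hx, hIoc hs⟩).hasFDerivWithinAt).hasFDerivAt_partial_left hU (hrU hx) (hIoc hs)

theorem hasDerivWithinAt_integral_Icc {E : Type*} [NormedAddCommGroup E] [NormedSpace ℝ E]
    [CompleteSpace E] {a b : ℝ} {g : ℝ → E} (hg : ContinuousOn g (Icc a b)) {t : ℝ}
    (ht : t ∈ Icc a b) :
    HasDerivWithinAt (fun x => ∫ s in a..x, g s) (g t) (Icc a b) t := by
  -- The `Fact` selects the `FTCFilter` instance for neighbourhoods within `Icc a b`, which also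
  -- covers the one-sided case at the endpoints.
  have : Fact (t ∈ Icc a b) := ⟨ht⟩
  have hsub : uIcc a t ⊆ Icc a b := by
    rw [uIcc_of_le ht.1]; exact Icc_subset_Icc le_rfl ht.2
  exact intervalIntegral.integral_hasDerivWithinAt_right (hg.mono hsub).intervalIntegrable
    (hg.stronglyMeasurableAtFilter_nhdsWithin measurableSet_Icc t) (hg t ht)

theorem integral_eq_sub_of_hasDerivWithinAt_Icc {E : Type*} [NormedAddCommGroup E]
    [NormedSpace ℝ E] [CompleteSpace E] {a b : ℝ} (hab : a ≤ b) {f f' : ℝ → E}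
    (hf : ∀ t ∈ Icc a b, HasDerivWithinAt f (f' t) (Icc a b) t)
    (hf' : ContinuousOn f' (Icc a b)) : ∫ s in a..b, f' s = f b - f a := by
  refine intervalIntegral.integral_eq_sub_of_hasDerivAt_of_le hab
    (fun t ht => (hf t ht).continuousWithinAt)
    (fun t ht => (hf t (Ioo_subset_Icc_self ht)).hasDerivAt (Icc_mem_nhds ht.1 ht.2)) ?_
  rw [← uIcc_of_le hab] at hf'
  exact hf'.intervalIntegrable

theorem ContDiffOn.succ_of_hasDerivWithinAt {E : Type*} [NormedAddCommGroup E] [NormedSpace ℝ E]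
    {S : Set ℝ} (hS : UniqueDiffOn ℝ S) {k : ℕ} {f f' : ℝ → E} (hf' : ContDiffOn ℝ k f' S)
    (hf : ∀ t ∈ S, HasDerivWithinAt f (f' t) S t) : ContDiffOn ℝ (k + 1) f S := by
  refine (contDiffOn_succ_iff_derivWithin hS).2
    ⟨fun t ht => (hf t ht).differentiableWithinAt, by simp, ?_⟩
  exact hf'.congr fun t ht => (hf t ht).derivWithin (hS t ht)

/-- Derivatives on the consecutive intervals `[k h, (k + 1) h]`, `k < N`, agree with the derivative
on their union. -/
theorem hasDerivWithinAt_Icc_of_consecutive {E : Type*} [NormedAddCommGroup E] [NormedSpace ℝ E]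
    {h : ℝ} (hh : 0 ≤ h) {f f' : ℝ → E} (N : ℕ)
    (hf : ∀ k < N, ∀ t ∈ Icc (k * h) ((k + 1) * h),
      HasDerivWithinAt f (f' t) (Icc (k * h) ((k + 1) * h)) t) (hN : N ≠ 0) :
    ∀ t ∈ Icc 0 (N * h), HasDerivWithinAt f (f' t) (Icc 0 (N * h)) t := by
  induction N with
  | zero => exact absurd rfl hN
  | succ N ih =>
    rcases Nat.eq_zero_or_pos N with rfl | hpos
    · simpa using hf 0 (by simp)
    · have ih' := ih (fun k hk => hf k (by omega)) (by omega)
      have hl := hf N (by omega)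
      have e : Icc (0 : ℝ) ((N + 1 : ℕ) * h) = Icc 0 (N * h) ∪ Icc (N * h) ((N + 1) * h) := by
        rw [Icc_union_Icc_eq_Icc (by positivity) (by nlinarith)]; push_cast; rfl
      intro t ht
      rw [e]
      refine HasDerivWithinAt.union ?_ ?_
      -- Outside a closed piece the derivative within it holds vacuously, so only the common node
      -- needs both halves. There the single function `f'` supplies the same value on either side.
      · by_cases h1 : t ∈ Icc 0 (N * h)
        · exact ih' t h1
        · exact HasFDerivWithinAt.of_notMem_closure (by rwa [isClosed_Icc.closure_eq])
      · by_cases h1 : t ∈ Icc (N * h) ((N + 1) * h)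
        · exact hl t h1
        · exact HasFDerivWithinAt.of_notMem_closure (by rwa [isClosed_Icc.closure_eq])

theorem HasDerivWithinAt.comp_add_const_Icc {E : Type*} [NormedAddCommGroup E] [NormedSpace ℝ E]
    {f : ℝ → E} {f' : E} {a b c : ℝ} {t : ℝ}
    (hf : HasDerivWithinAt f f' (Icc (a + c) (b + c)) (t + c)) :
    HasDerivWithinAt (fun s => f (s + c)) f' (Icc a b) t := by
  have h1 : HasDerivWithinAt (fun s : ℝ => s + c) 1 (Icc a b) t :=
    ((hasDerivAt_id t).add_const c).hasDerivWithinAt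
  have := hf.scomp t h1 (fun s (hs : s ∈ Icc a b) =>
    (⟨by linarith [hs.1], by linarith [hs.2]⟩ : s + c ∈ Icc (a + c) (b + c)))
  rwa [one_smul] at this

/-- Over ℝ the conjugate-linear isometry `adjoint` is linear, hence smooth; this carries C¹
dependence on q over to ρᵀ and the transposed derivatives of f. -/
theorem isBoundedLinearMap_adjoint (E F : Type*) [NormedAddCommGroup E] [InnerProductSpace ℝ E]
    [CompleteSpace E] [NormedAddCommGroup F] [InnerProductSpace ℝ F] [CompleteSpace F] :
    IsBoundedLinearMap ℝ
      (fun A : E →L[ℝ] F => (ContinuousLinearMap.adjoint A : F →L[ℝ] E)) := by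
  refine ⟨⟨fun A B => map_add _ A B, fun c A => by simp⟩, 1, one_pos, fun A => ?_⟩
  rw [one_mul]
  exact (LinearIsometryEquiv.norm_map _ A).le

/-! ### The metric g, the form b, the optimal control, and the first derivatives of L̃. -/

namespace ControlProblem

variable {n m : ℕ} (P : ControlProblem n m)

theorem g_contDiffOn : ContDiffOn ℝ 1 P.g P.Q :=
  ((isBoundedLinearMap_adjoint _ _).contDiff.comp_contDiffOn P.ρ_contDiffOn).clm_comp
    (P.gQ_contDiffOn.clm_comp P.ρ_contDiffOn)

theorem inner_g (q : Coord n) (u w : Coord m) :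
    inner ℝ u (P.g q w) = inner ℝ (P.ρ q u) (P.gQ q (P.ρ q w)) := by
  simp [g, ContinuousLinearMap.adjoint_inner_right]

theorem g_symm {q : Coord n} (hq : q ∈ P.Q) (u w : Coord m) :
    (inner ℝ (P.g q u) w : ℝ) = inner ℝ u (P.g q w) := by
  rw [real_inner_comm, inner_g, inner_g, real_inner_comm, P.gQ_symm q hq]

/-- uᵀ g u is the `gQ`-square of ρu, positive for u ≠ 0 since ρ is injective. -/
theorem g_injective {q : Coord n} (hq : q ∈ P.Q) : Function.Injective (P.g q) := by
  refine (injective_iff_map_eq_zero _).2 fun u hu => ?_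
  by_contra hne
  have hpos := P.gQ_pos q hq (P.ρ q u) fun h0 =>
    hne (P.ρ_injective q hq (by rw [h0, map_zero]))
  rw [← inner_g, hu, inner_zero_right] at hpos
  exact lt_irrefl _ hpos

theorem exists_equiv_g {q : Coord n} (hq : q ∈ P.Q) :
    ∃ e : Coord m ≃L[ℝ] Coord m, (e : Coord m →L[ℝ] Coord m) = P.g q :=
  ⟨(LinearEquiv.ofInjectiveEndo (P.g q : Coord m →ₗ[ℝ] Coord m)
    (P.g_injective hq)).toContinuousLinearEquiv, by ext u; rfl⟩

theorem g_inverse_contDiffOn : ContDiffOn ℝ 1 (fun q => (P.g q).inverse) P.Q := by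
  intro q hq
  obtain ⟨e, he⟩ := P.exists_equiv_g hq
  have h1 := contDiffAt_map_inverse (𝕜 := ℝ) (n := 1) e
  rw [he] at h1
  exact h1.comp_contDiffWithinAt q (P.g_contDiffOn q hq)

theorem b_contDiffOn : ContDiffOn ℝ 1 P.b P.Q :=
  P.ρ_contDiffOn.clm_comp (P.g_inverse_contDiffOn.clm_comp
    ((isBoundedLinearMap_adjoint _ _).contDiff.comp_contDiffOn P.ρ_contDiffOn))

/-- The control `u = g⁻¹ ρᵀ λ` minimising the control Hamiltonian. -/
def optControl (q l : Coord n) : Coord m :=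
  (P.g q).inverse (ContinuousLinearMap.adjoint (P.ρ q) l)

theorem ρ_optControl (q l : Coord n) : P.ρ q (P.optControl q l) = P.b q l := rfl

theorem g_optControl {q : Coord n} (hq : q ∈ P.Q) (l : Coord n) :
    P.g q (P.optControl q l) = ContinuousLinearMap.adjoint (P.ρ q) l := by
  obtain ⟨e, he⟩ := P.exists_equiv_g hq
  simp [optControl, ← he]

theorem optControl_contDiffOn :
    ContDiffOn ℝ 1 (fun z : Coord n × Coord n => P.optControl z.1 z.2) (P.Q ×ˢ univ) := by
  have h1 : ContDiffOn ℝ 1 (fun q => (P.g q).inverse.comp (ContinuousLinearMap.adjoint (P.ρ q)))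
      P.Q := P.g_inverse_contDiffOn.clm_comp
    ((isBoundedLinearMap_adjoint _ _).contDiff.comp_contDiffOn P.ρ_contDiffOn)
  exact (h1.comp contDiffOn_fst fun z hz => hz.1).clm_apply contDiffOn_snd

theorem inner_b {q : Coord n} (hq : q ∈ P.Q) (l l' : Coord n) :
    (inner ℝ l (P.b q l') : ℝ) = inner ℝ (P.optControl q l) (P.g q (P.optControl q l')) := by
  rw [← g_symm P hq, g_optControl P hq, ContinuousLinearMap.adjoint_inner_left, ρ_optControl]

theorem b_symm {q : Coord n} (hq : q ∈ P.Q) (l l' : Coord n) :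
    (inner ℝ (P.b q l) l' : ℝ) = inner ℝ l (P.b q l') := by
  rw [real_inner_comm, inner_b P hq, inner_b P hq, real_inner_comm, g_symm P hq]

theorem b_hasFDerivAt {q : Coord n} (hq : q ∈ P.Q) : HasFDerivAt P.b (fderiv ℝ P.b q) q :=
  ((P.b_contDiffOn.contDiffAt (P.isOpen_Q.mem_nhds hq)).differentiableAt
    one_ne_zero).hasFDerivAt

theorem ρ_hasFDerivAt {q : Coord n} (hq : q ∈ P.Q) : HasFDerivAt P.ρ (fderiv ℝ P.ρ q) q :=
  ((P.ρ_contDiffOn.contDiffAt (P.isOpen_Q.mem_nhds hq)).differentiableAt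
    one_ne_zero).hasFDerivAt

theorem g_hasFDerivAt {q : Coord n} (hq : q ∈ P.Q) : HasFDerivAt P.g (fderiv ℝ P.g q) q :=
  ((P.g_contDiffOn.contDiffAt (P.isOpen_Q.mem_nhds hq)).differentiableAt
    one_ne_zero).hasFDerivAt

theorem optControl_differentiableAt {q : Coord n} (hq : q ∈ P.Q) (l : Coord n) :
    DifferentiableAt ℝ (fun q' => P.optControl q' l) q := by
  have h1 : ContDiffAt ℝ 1 (fun z : Coord n × Coord n => P.optControl z.1 z.2) (q, l) :=
    P.optControl_contDiffOn.contDiffAt ((P.isOpen_Q.prod isOpen_univ).mem_nhds ⟨hq, mem_univ _⟩)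
  exact (h1.differentiableAt one_ne_zero).comp q (f := fun q' => (q', l)) (by fun_prop)

theorem inner_gradient_b {q : Coord n} (hq : q ∈ P.Q) (l v : Coord n) :
    (inner ℝ (gradient (fun q' => (inner ℝ l (P.b q' l) : ℝ)) q) v : ℝ) =
      inner ℝ l (fderiv ℝ P.b q v l) := by
  rw [inner_gradient_left]
  have h1 : HasFDerivAt (fun q' => P.b q' l) ((fderiv ℝ P.b q).flip l) q :=
    ((P.b_hasFDerivAt hq).clm_apply (hasFDerivAt_const l q)).congr_fderiv (by ext; simp)
  have h2 := (hasFDerivAt_const l q).inner ℝ h1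
  rw [h2.fderiv]
  simp

/-- Envelope identity: `½ ∂_q b(λ, λ) = (∂_q ρ u)ᵀ λ - ½ ∂_q g(u, u)` for `u = g⁻¹ ρᵀ λ`. -/
theorem half_gradient_b {q : Coord n} (hq : q ∈ P.Q) (l : Coord n) :
    (1 / 2 : ℝ) • gradient (fun q' => (inner ℝ l (P.b q' l) : ℝ)) q =
      ContinuousLinearMap.adjoint (fderiv ℝ (fun q' => P.ρ q' (P.optControl q l)) q) l
      - (1 / 2 : ℝ) •
        gradient (fun q' => (inner ℝ (P.optControl q l) (P.g q' (P.optControl q l)) : ℝ)) q := by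
  set u := P.optControl q l with hu
  have hρ : HasFDerivAt (fun q' => P.ρ q' u) ((fderiv ℝ P.ρ q).flip u) q :=
    ((P.ρ_hasFDerivAt hq).clm_apply (hasFDerivAt_const u q)).congr_fderiv (by ext; simp)
  have hg : HasFDerivAt (fun q' => P.g q' u) ((fderiv ℝ P.g q).flip u) q :=
    ((P.g_hasFDerivAt hq).clm_apply (hasFDerivAt_const u q)).congr_fderiv (by ext; simp)
  have hw : HasFDerivAt (fun q' => P.optControl q' l - u)
      (fderiv ℝ (fun q' => P.optControl q' l) q) q :=
    (P.optControl_differentiableAt hq l).hasFDerivAt.sub_const u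
  have hgw := (P.g_hasFDerivAt hq).clm_apply hw
  have hsq := hw.inner ℝ hgw
  have hlin := ((hasFDerivAt_const l q).inner ℝ hρ).const_mul 2
  have hquad := (hasFDerivAt_const u q).inner ℝ hg
  have htot := (hlin.sub hquad).add hsq
  -- Completing the square with u frozen: the difference between λᵀbλ and 2λᵀρu - uᵀgu is the
  -- g-square of u(q') - u. It vanishes to second order at q, so the derivatives of g⁻¹ and of u(q')
  -- never contribute.
  have heq : (fun q' => (inner ℝ l (P.b q' l) : ℝ)) =ᶠ[nhds q]
      fun q' => 2 * inner ℝ l (P.ρ q' u) - inner ℝ u (P.g q' u)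
        + inner ℝ (P.optControl q' l - u) (P.g q' (P.optControl q' l - u)) := by
    filter_upwards [P.isOpen_Q.mem_nhds hq] with x hx
    rw [inner_b P hx, map_sub, inner_sub_left, inner_sub_right, inner_sub_right,
      ← g_symm P hx (P.optControl x l) u, ← g_symm P hx (P.optControl x l) (P.optControl x l),
      g_optControl P hx, real_inner_comm (ContinuousLinearMap.adjoint (P.ρ x) l) u,
      ContinuousLinearMap.adjoint_inner_left, ContinuousLinearMap.adjoint_inner_left]
    ring
  refine ext_inner_right ℝ fun v => ?_
  rw [inner_smul_left, inner_gradient_left, heq.fderiv_eq]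
  erw [htot.fderiv]
  rw [inner_sub_left, inner_smul_left, inner_gradient_left, hquad.fderiv,
    ContinuousLinearMap.adjoint_inner_left, hρ.fderiv]
  simp [← hu]
  ring

theorem f_hasFDerivAt {q : Coord n} (hq : q ∈ P.Q) (v : Coord n) :
    HasFDerivAt (fun z : Coord n × Coord n => P.f z.1 z.2)
      (fderiv ℝ (fun z : Coord n × Coord n => P.f z.1 z.2) (q, v)) (q, v) :=
  ((P.f_contDiffOn.contDiffAt ((P.isOpen_Q.prod isOpen_univ).mem_nhds
    ⟨hq, mem_univ _⟩)).differentiableAt two_ne_zero).hasFDerivAt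

theorem f_hasFDerivAt_left {q : Coord n} (hq : q ∈ P.Q) (v : Coord n) :
    HasFDerivAt (fun q' => P.f q' v) ((fderiv ℝ (fun z : Coord n × Coord n => P.f z.1 z.2)
      (q, v)).comp (ContinuousLinearMap.inl ℝ _ _)) q :=
  HasFDerivAt.comp (f := fun q' => (q', v)) q (P.f_hasFDerivAt hq v) (hasFDerivAt_prodMk_left q v)

theorem f_hasFDerivAt_right {q : Coord n} (hq : q ∈ P.Q) (v : Coord n) :
    HasFDerivAt (fun v' => P.f q v') ((fderiv ℝ (fun z : Coord n × Coord n => P.f z.1 z.2)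
      (q, v)).comp (ContinuousLinearMap.inr ℝ _ _)) v :=
  HasFDerivAt.comp (f := fun v' => (q, v')) v (P.f_hasFDerivAt hq v) (hasFDerivAt_prodMk_right q v)

theorem inner_fderiv_f {q : Coord n} (hq : q ∈ P.Q) (v l : Coord n) (w : Coord n × Coord n) :
    (inner ℝ l (fderiv ℝ (fun z : Coord n × Coord n => P.f z.1 z.2) (q, v) w) : ℝ) =
      inner ℝ (P.dfqT q v l) w.1 + inner ℝ (P.dfvT q v l) w.2 := by
  rw [dfqT, dfvT, ContinuousLinearMap.adjoint_inner_left, ContinuousLinearMap.adjoint_inner_left,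
    (P.f_hasFDerivAt_left hq v).fderiv, (P.f_hasFDerivAt_right hq v).fderiv, ← inner_add_right]
  simp only [ContinuousLinearMap.comp_apply, ← map_add]
  simp

theorem fderiv_f_contDiffOn : ContDiffOn ℝ 1
    (fderiv ℝ (fun z : Coord n × Coord n => P.f z.1 z.2)) (P.Q ×ˢ univ) :=
  P.f_contDiffOn.fderiv_of_isOpen (P.isOpen_Q.prod isOpen_univ) (by norm_num)

theorem dfvT_contDiffOn :
    ContDiffOn ℝ 1 (fun z : Coord n × Coord n => P.dfvT z.1 z.2) (P.Q ×ˢ univ) := by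
  refine ((isBoundedLinearMap_adjoint _ _).contDiff.comp_contDiffOn
    (P.fderiv_f_contDiffOn.clm_comp (contDiffOn_const (c := ContinuousLinearMap.inr ℝ _ _)))).congr
    fun z hz => ?_
  rw [dfvT, (P.f_hasFDerivAt_right hz.1 z.2).fderiv]
  rfl

theorem dfqT_contDiffOn :
    ContDiffOn ℝ 1 (fun z : Coord n × Coord n => P.dfqT z.1 z.2) (P.Q ×ˢ univ) := by
  refine ((isBoundedLinearMap_adjoint _ _).contDiff.comp_contDiffOn
    (P.fderiv_f_contDiffOn.clm_comp (contDiffOn_const (c := ContinuousLinearMap.inl ℝ _ _)))).congr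
    fun z hz => ?_
  rw [dfqT, (P.f_hasFDerivAt_left hz.1 z.2).fderiv]
  rfl

/-- `(∂L/∂q)ᵀ` for the Lagrangian `lagrangian`. -/
def lagrangianForce (q v l : Coord n) : Coord n :=
  (1 / 2 : ℝ) • gradient (fun q' => (inner ℝ l (P.b q' l) : ℝ)) q + P.dfqT q v l

theorem lagrangianForce_continuousOn {S : Set ℝ} {q v l : ℝ → Coord n} (hQ : ∀ t ∈ S, q t ∈ P.Q)
    (hq : ContinuousOn q S) (hv : ContinuousOn v S) (hl : ContinuousOn l S) :
    ContinuousOn (fun t => P.lagrangianForce (q t) (v t) (l t)) S := by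
  have h1 : ContinuousOn (fun t => P.dfqT (q t) (v t) (l t)) S :=
    (P.dfqT_contDiffOn.continuousOn.comp (hq.prodMk hv) fun t ht => ⟨hQ t ht, mem_univ _⟩).clm_apply
      hl
  have h2 : ContinuousOn (fun t => fderiv ℝ P.b (q t)) S :=
    (P.b_contDiffOn.continuousOn_fderiv_of_isOpen P.isOpen_Q le_rfl).comp hq hQ
  -- The gradient is rewritten as the Riesz dual of a covector explicit in `fderiv ℝ P.b`, because
  -- the function being differentiated itself varies with t through λ(t).
  have h3 : ContinuousOn (fun t =>
      (InnerProductSpace.toDual ℝ (Coord n)).symm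
        ((innerSL ℝ (l t)).comp ((fderiv ℝ P.b (q t)).flip (l t)))) S := by
    refine (LinearIsometryEquiv.continuous _).comp_continuousOn
      (((innerSL ℝ).continuous.comp_continuousOn hl).clm_comp (ContinuousOn.clm_apply ?_ hl))
    exact (ContinuousLinearMap.flipₗᵢ ℝ (Coord n) (Coord n)
      (Coord n)).continuous.comp_continuousOn h2
  refine ((h3.const_smul (1 / 2 : ℝ)).congr fun t ht => ?_).add h1
  refine congrArg (fun x : Coord n => (1 / 2 : ℝ) • x) ?_
  refine ext_inner_right ℝ fun w => ?_
  rw [P.inner_gradient_b (hQ t ht), InnerProductSpace.toDual_symm_apply]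
  rfl

theorem isOpen_lagrangianDomain :
    IsOpen {z : Phase n × Phase n | z.1.1 ∈ P.Q} :=
  P.isOpen_Q.preimage (by fun_prop)

theorem lagrangian_contDiffOn :
    ContDiffOn ℝ 1 (fun z : Phase n × Phase n => P.lagrangian z.1 z.2) {z | z.1.1 ∈ P.Q} := by
  have h1 : ContDiffOn ℝ 1 (fun z : Phase n × Phase n => P.f z.1.1 z.2.1) {z | z.1.1 ∈ P.Q} :=
    (P.f_contDiffOn.of_le (by norm_num)).comp
      (f := fun z : Phase n × Phase n => ((z.1.1, z.2.1) : Coord n × Coord n))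
      (by fun_prop) fun z hz => ⟨hz, mem_univ _⟩
  have h2 : ContDiffOn ℝ 1 (fun z : Phase n × Phase n => P.b z.1.1 z.1.2) {z | z.1.1 ∈ P.Q} :=
    (P.b_contDiffOn.comp (f := fun z : Phase n × Phase n => z.1.1) (by fun_prop)
      fun z hz => hz).clm_apply (by fun_prop)
  unfold lagrangian
  exact ((ContDiffOn.inner ℝ (by fun_prop) (by fun_prop)).add
    (ContDiffOn.inner ℝ (by fun_prop) h1)).add
    (contDiffOn_const.mul (ContDiffOn.inner ℝ (by fun_prop) h2))

/-- The four coefficients are the momenta p and q̇ and the corresponding forces; along a solution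
the forces are the time derivatives of the momenta. -/
theorem fderiv_lagrangian_apply {y w : Phase n} (hy : y.1 ∈ P.Q) (η ω : Phase n) :
    fderiv ℝ (fun z : Phase n × Phase n => P.lagrangian z.1 z.2) (y, w) (η, ω) =
      inner ℝ (w.2 + P.dfvT y.1 w.1 y.2) ω.1 + inner ℝ w.1 ω.2
      + inner ℝ (P.lagrangianForce y.1 w.1 y.2) η.1
      + inner ℝ (P.f y.1 w.1 + P.b y.1 y.2) η.2 := by
  set z₀ : Phase n × Phase n := (y, w)
  have hq : HasFDerivAt (fun z : Phase n × Phase n => z.1.1) _ z₀ :=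
    ((ContinuousLinearMap.fst ℝ (Coord n) (Coord n)).comp
      (ContinuousLinearMap.fst ℝ (Phase n) (Phase n))).hasFDerivAt
  have hl : HasFDerivAt (fun z : Phase n × Phase n => z.1.2) _ z₀ :=
    ((ContinuousLinearMap.snd ℝ (Coord n) (Coord n)).comp
      (ContinuousLinearMap.fst ℝ (Phase n) (Phase n))).hasFDerivAt
  have hv : HasFDerivAt (fun z : Phase n × Phase n => z.2.1) _ z₀ :=
    ((ContinuousLinearMap.fst ℝ (Coord n) (Coord n)).comp
      (ContinuousLinearMap.snd ℝ (Phase n) (Phase n))).hasFDerivAt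
  have hk : HasFDerivAt (fun z : Phase n × Phase n => z.2.2) _ z₀ :=
    ((ContinuousLinearMap.snd ℝ (Coord n) (Coord n)).comp
      (ContinuousLinearMap.snd ℝ (Phase n) (Phase n))).hasFDerivAt
  have hf := (P.f_hasFDerivAt hy w.1).comp z₀ (hq.prodMk hv)
  have hb := ((P.b_hasFDerivAt hy).comp z₀ hq).clm_apply hl
  have htot := ((hk.inner ℝ hv).add (hl.inner ℝ hf)).add ((hl.inner ℝ hb).const_mul (1 / 2 : ℝ))
  erw [htot.fderiv]
  have hfi := P.inner_fderiv_f hy w.1 y.2 (η.1, ω.1)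
  have hbi := P.inner_gradient_b hy y.2 η.1
  -- Symmetry of b merges the two halves of the derivative of ½λᵀbλ in λ.
  have hbs := P.b_symm hy y.2 η.2
  simp [z₀, lagrangianForce, inner_add_left, inner_add_right, inner_smul_left] at hfi ⊢
  rw [inner_gradient_left] at hbi
  rw [hbi, hfi, ← hbs, real_inner_comm w.1 ω.2, real_inner_comm (P.f y.1 w.1) η.2,
    real_inner_comm (P.b y.1 y.2) η.2]
  ring

end ControlProblem

/-! ### The Euler-Lagrange equations as a first-order system, and elimination of the control. -/

namespace ControlProblem

variable {n m : ℕ} (P : ControlProblem n m)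

/-- The Euler-Lagrange equations of `lagrangian` on `S` as a first-order system for `(q, λ)`, the
velocity `v` of `q` and the momentum `p = λ' + (∂f/∂q')ᵀ λ` conjugate to `q`. -/
structure IsELFlow (S : Set ℝ) (q l v p : ℝ → Coord n) : Prop where
  mem_Q : ∀ t ∈ S, q t ∈ P.Q
  deriv_q : ∀ t ∈ S, HasDerivWithinAt q (v t) S t
  deriv_l : ∀ t ∈ S, HasDerivWithinAt l (p t - P.dfvT (q t) (v t) (l t)) S t
  deriv_v : ∀ t ∈ S, HasDerivWithinAt v (P.f (q t) (v t) + P.b (q t) (l t)) S t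
  deriv_p : ∀ t ∈ S, HasDerivWithinAt p (P.lagrangianForce (q t) (v t) (l t)) S t

variable {P}

theorem dfvT_comp_contDiffOn {S : Set ℝ} {q v l : ℝ → Coord n} (hQ : ∀ t ∈ S, q t ∈ P.Q)
    (hq : ContDiffOn ℝ 1 q S) (hv : ContDiffOn ℝ 1 v S) (hl : ContDiffOn ℝ 1 l S) :
    ContDiffOn ℝ 1 (fun t => P.dfvT (q t) (v t) (l t)) S :=
  (P.dfvT_contDiffOn.comp (hq.prodMk hv) fun t ht => ⟨hQ t ht, mem_univ _⟩).clm_apply hl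

namespace IsELFlow

variable {S : Set ℝ} {q l v p : ℝ → Coord n}

theorem congr (H : P.IsELFlow S q l v p) {q' l' v' p' : ℝ → Coord n} (hq : EqOn q' q S)
    (hl : EqOn l' l S) (hv : EqOn v' v S) (hp : EqOn p' p S) : P.IsELFlow S q' l' v' p' where
  mem_Q t ht := by rw [hq ht]; exact H.mem_Q t ht
  deriv_q t ht := by rw [hv ht]; exact (H.deriv_q t ht).congr_of_mem hq ht
  deriv_l t ht := by rw [hq ht, hl ht, hv ht, hp ht]; exact (H.deriv_l t ht).congr_of_mem hl ht
  deriv_v t ht := by rw [hq ht, hl ht, hv ht]; exact (H.deriv_v t ht).congr_of_mem hv ht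
  deriv_p t ht := by rw [hq ht, hl ht, hv ht]; exact (H.deriv_p t ht).congr_of_mem hp ht

theorem mono (H : P.IsELFlow S q l v p) {S' : Set ℝ} (h : S' ⊆ S) : P.IsELFlow S' q l v p where
  mem_Q t ht := H.mem_Q t (h ht)
  deriv_q t ht := (H.deriv_q t (h ht)).mono h
  deriv_l t ht := (H.deriv_l t (h ht)).mono h
  deriv_v t ht := (H.deriv_v t (h ht)).mono h
  deriv_p t ht := (H.deriv_p t (h ht)).mono h

theorem comp_add_const {a b c : ℝ} (H : P.IsELFlow (Icc (a + c) (b + c)) q l v p) :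
    P.IsELFlow (Icc a b) (fun t => q (t + c)) (fun t => l (t + c)) (fun t => v (t + c))
      (fun t => p (t + c)) := by
  have hm : ∀ t ∈ Icc a b, t + c ∈ Icc (a + c) (b + c) := fun t ht =>
    ⟨by linarith [ht.1], by linarith [ht.2]⟩
  exact
  { mem_Q := fun t ht => H.mem_Q _ (hm t ht)
    deriv_q := fun t ht => (H.deriv_q _ (hm t ht)).comp_add_const_Icc
    deriv_l := fun t ht => (H.deriv_l _ (hm t ht)).comp_add_const_Icc
    deriv_v := fun t ht => (H.deriv_v _ (hm t ht)).comp_add_const_Icc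
    deriv_p := fun t ht => (H.deriv_p _ (hm t ht)).comp_add_const_Icc }

theorem of_consecutive {h : ℝ} (hh : 0 ≤ h) {N : ℕ} (hN : N ≠ 0)
    (H : ∀ k < N, P.IsELFlow (Icc (k * h) ((k + 1) * h)) q l v p)
    (hQ : ∀ t ∈ Icc 0 (N * h), q t ∈ P.Q) : P.IsELFlow (Icc 0 (N * h)) q l v p where
  mem_Q := hQ
  deriv_q := hasDerivWithinAt_Icc_of_consecutive hh N (fun k hk => (H k hk).deriv_q) hN
  deriv_l := hasDerivWithinAt_Icc_of_consecutive hh N (fun k hk => (H k hk).deriv_l) hN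
  deriv_v := hasDerivWithinAt_Icc_of_consecutive hh N (fun k hk => (H k hk).deriv_v) hN
  deriv_p := hasDerivWithinAt_Icc_of_consecutive hh N (fun k hk => (H k hk).deriv_p) hN

/-- Start of the bootstrap: the right sides are continuous in the state, so all four components are
C¹. Then λ' = p - (∂f/∂q̇)ᵀλ is C¹ because f is C², giving λ ∈ C²; and v' = f + bλ is C¹, giving v ∈
C² and q ∈ C³. -/
theorem contDiffOn_one (H : P.IsELFlow S q l v p) (hS : UniqueDiffOn ℝ S) :
    ContDiffOn ℝ 1 q S ∧ ContDiffOn ℝ 1 v S ∧ ContDiffOn ℝ 1 l S ∧ ContDiffOn ℝ 1 p S := by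
  have cq : ContinuousOn q S := fun t ht => (H.deriv_q t ht).continuousWithinAt
  have cl : ContinuousOn l S := fun t ht => (H.deriv_l t ht).continuousWithinAt
  have cv : ContinuousOn v S := fun t ht => (H.deriv_v t ht).continuousWithinAt
  have cp : ContinuousOn p S := fun t ht => (H.deriv_p t ht).continuousWithinAt
  have up : ∀ {x x' : ℝ → Coord n}, ContinuousOn x' S →
      (∀ t ∈ S, HasDerivWithinAt x (x' t) S t) → ContDiffOn ℝ 1 x S := fun hx' hx => by
    have := ContDiffOn.succ_of_hasDerivWithinAt hS (k := 0) (contDiffOn_zero.2 hx') hx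
    simpa using this
  have cqv : ContinuousOn (fun t => (q t, v t)) S := cq.prodMk cv
  have hm : ∀ t ∈ S, (q t, v t) ∈ P.Q ×ˢ (univ : Set (Coord n)) :=
    fun t ht => ⟨H.mem_Q t ht, mem_univ _⟩
  exact ⟨up cv H.deriv_q,
    up ((P.f_contDiffOn.continuousOn.comp cqv hm).add
      ((P.b_contDiffOn.continuousOn.comp cq H.mem_Q).clm_apply cl)) H.deriv_v,
    up (cp.sub ((P.dfvT_contDiffOn.continuousOn.comp cqv hm).clm_apply cl)) H.deriv_l,
    up (P.lagrangianForce_continuousOn H.mem_Q cq cv cl) H.deriv_p⟩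

theorem contDiffOn_dfvT (H : P.IsELFlow S q l v p) (hS : UniqueDiffOn ℝ S) :
    ContDiffOn ℝ 1 (fun t => P.dfvT (q t) (v t) (l t)) S := by
  obtain ⟨hq, hv, hl, -⟩ := H.contDiffOn_one hS
  exact dfvT_comp_contDiffOn H.mem_Q hq hv hl

theorem contDiffOn_l (H : P.IsELFlow S q l v p) (hS : UniqueDiffOn ℝ S) :
    ContDiffOn ℝ 2 l S := by
  obtain ⟨-, -, -, hp⟩ := H.contDiffOn_one hS
  have := ContDiffOn.succ_of_hasDerivWithinAt hS (k := 1)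
    (by exact_mod_cast hp.sub (H.contDiffOn_dfvT hS)) H.deriv_l
  exact_mod_cast this

theorem contDiffOn_q (H : P.IsELFlow S q l v p) (hS : UniqueDiffOn ℝ S) :
    ContDiffOn ℝ 3 q S := by
  obtain ⟨hq, hv, hl, -⟩ := H.contDiffOn_one hS
  have h1 : ContDiffOn ℝ 1 (fun t => P.f (q t) (v t) + P.b (q t) (l t)) S :=
    ((P.f_contDiffOn.of_le (by norm_num)).comp (hq.prodMk hv)
      fun t ht => ⟨H.mem_Q t ht, mem_univ _⟩).add
      ((P.b_contDiffOn.comp hq H.mem_Q).clm_apply hl)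
  have h2 := ContDiffOn.succ_of_hasDerivWithinAt hS (k := 1) (by exact_mod_cast h1) H.deriv_v
  have h3 := ContDiffOn.succ_of_hasDerivWithinAt hS (k := 2) (by exact_mod_cast h2) H.deriv_q
  exact_mod_cast h3

theorem isELSolution {h : ℝ} (hh : 0 < h) {c : ℝ → Phase n}
    (H : P.IsELFlow (Icc 0 h) (fun t => (c t).1) (fun t => (c t).2) v p) :
    P.IsELSolution h c := by
  have hS := uniqueDiffOn_Icc hh
  have dq : EqOn (derivWithin (fun t => (c t).1) (Icc 0 h)) v (Icc 0 h) :=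
    fun t ht => (H.deriv_q t ht).derivWithin (hS t ht)
  have dl : EqOn (derivWithin (fun t => (c t).2) (Icc 0 h))
      (fun t => p t - P.dfvT (c t).1 (v t) (c t).2) (Icc 0 h) :=
    fun t ht => (H.deriv_l t ht).derivWithin (hS t ht)
  refine ⟨H.contDiffOn_q hS, H.contDiffOn_l hS, H.mem_Q, fun t ht => ?_, fun t ht => ?_⟩
  -- λ'' is recovered by differentiating p - (∂f/∂q̇)ᵀλ termwise, which needs the second term to be
  -- differentiable on its own.
  · have hd := (H.contDiffOn_dfvT hS).differentiableOn one_ne_zero t ht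
    rw [derivWithin_congr dl (dl ht), dq ht]
    refine (((H.deriv_p t ht).sub hd.hasDerivWithinAt).derivWithin (hS t ht)).trans ?_
    rw [derivWithin_congr
      (f := fun s => P.dfvT (c s).1 (derivWithin (fun r => (c r).1) (Icc 0 h) s) (c s).2)
      (fun s hs => by simp only [dq hs]) (by simp only [dq ht])]
    rfl
  · rw [derivWithin_congr dq (dq ht), (H.deriv_v t ht).derivWithin (hS t ht), dq ht]

end IsELFlow

theorem IsELSolution.isELFlow {h : ℝ} (hh : 0 < h) {c : ℝ → Phase n} (H : P.IsELSolution h c) :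
    P.IsELFlow (Icc 0 h) (fun t => (c t).1) (fun t => (c t).2)
      (derivWithin (fun t => (c t).1) (Icc 0 h))
      (fun t => derivWithin (fun t => (c t).2) (Icc 0 h) t
        + P.dfvT (c t).1 (derivWithin (fun t => (c t).1) (Icc 0 h) t) (c t).2) := by
  have hS := uniqueDiffOn_Icc hh
  have hv : ContDiffOn ℝ 1 (derivWithin (fun t => (c t).1) (Icc 0 h)) (Icc 0 h) :=
    H.contDiff_q.derivWithin hS (by norm_num)
  have hk : ContDiffOn ℝ 1 (derivWithin (fun t => (c t).2) (Icc 0 h)) (Icc 0 h) :=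
    H.contDiff_l.derivWithin hS (by norm_num)
  have hd := dfvT_comp_contDiffOn H.mem_Q (H.contDiff_q.of_le (by norm_num)) hv
    (H.contDiff_l.of_le (by norm_num))
  refine ⟨H.mem_Q, fun t ht => ?_, fun t ht => ?_, fun t ht => ?_, fun t ht => ?_⟩
  · exact (H.contDiff_q.differentiableOn (by norm_num) t ht).hasDerivWithinAt
  · rw [add_sub_cancel_right]
    exact (H.contDiff_l.differentiableOn (by norm_num) t ht).hasDerivWithinAt
  · rw [← H.state_dynamics t ht]
    exact (hv.differentiableOn one_ne_zero t ht).hasDerivWithinAt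
  · have h1 := ((hk.differentiableOn one_ne_zero t ht).hasDerivWithinAt).add
      (hd.differentiableOn one_ne_zero t ht).hasDerivWithinAt
    rw [H.adjoint_dynamics t ht, sub_add_cancel] at h1
    exact h1

theorem optControl_eq {q l : Coord n} (hq : q ∈ P.Q) {u : Coord m}
    (hu : P.g q u = ContinuousLinearMap.adjoint (P.ρ q) l) : u = P.optControl q l :=
  P.g_injective hq (by rw [hu, P.g_optControl hq])

/-- Injectivity of g forces u = g⁻¹ρᵀλ; then ρu = bλ, and the envelope identity replaces the
u-dependent terms of the adjoint equation. -/
theorem IsContinuousOptimal.isELSolution {T : ℝ} {q0 v0 : Coord n} {y : ℝ → Phase n}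
    {u : ℝ → Coord m} {μ ν : Coord n} (H : P.IsContinuousOptimal T q0 v0 y u μ ν) :
    P.IsELSolution T y := by
  refine ⟨H.contDiff_q, H.contDiff_l, H.mem_Q, fun t ht => ?_, fun t ht => ?_⟩
  · rw [H.adjoint_dynamics t ht, P.half_gradient_b (H.mem_Q t ht),
      ← optControl_eq (H.mem_Q t ht) (H.minimisation t ht)]
    abel
  · rw [H.state_dynamics t ht, ← P.ρ_optControl,
      ← optControl_eq (H.mem_Q t ht) (H.minimisation t ht)]

theorem IsELSolution.isContinuousOptimal {T : ℝ} {y : ℝ → Phase n} (H : P.IsELSolution T y)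
    {q0 v0 μ ν : Coord n} (initial_q : (y 0).1 = q0)
    (initial_v : derivWithin (fun s => (y s).1) (Icc 0 T) 0 = v0)
    (transversality_mu : μ = -derivWithin (fun s => (y s).2) (Icc 0 T) 0
      - P.dfvT (y 0).1 (derivWithin (fun s => (y s).1) (Icc 0 T) 0) (y 0).2)
    (transversality_nu : ν = (y 0).2)
    (transversality_dl : derivWithin (fun s => (y s).2) (Icc 0 T) T =
      P.gradPhiQ (y T).1 (derivWithin (fun s => (y s).1) (Icc 0 T) T)
      + P.dfvT (y T).1 (derivWithin (fun s => (y s).1) (Icc 0 T) T)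
          (P.gradPhiV (y T).1 (derivWithin (fun s => (y s).1) (Icc 0 T) T)))
    (transversality_l : (y T).2 =
      -P.gradPhiV (y T).1 (derivWithin (fun s => (y s).1) (Icc 0 T) T)) :
    P.IsContinuousOptimal T q0 v0 y (fun t => P.optControl (y t).1 (y t).2) μ ν where
  contDiff_q := H.contDiff_q
  contDiff_l := H.contDiff_l
  contDiff_u := P.optControl_contDiffOn.comp
    (f := fun t => ((y t).1, (y t).2))
    ((H.contDiff_q.of_le (by norm_num)).prodMk (H.contDiff_l.of_le (by norm_num)))
    fun t ht => ⟨H.mem_Q t ht, mem_univ _⟩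
  mem_Q := H.mem_Q
  adjoint_dynamics t ht := by
    rw [H.adjoint_dynamics t ht, P.half_gradient_b (H.mem_Q t ht)]
    abel
  state_dynamics t ht := H.state_dynamics t ht
  minimisation t ht := P.g_optControl (H.mem_Q t ht) _
  initial_q := initial_q
  initial_v := initial_v
  transversality_mu := transversality_mu
  transversality_nu := transversality_nu
  transversality_dl := transversality_dl
  transversality_l := transversality_l

end ControlProblem

/-! ### Variation of the solution segments and the derivative of the exact discrete Lagrangian. -/

namespace ControlProblem

variable {n m : ℕ} {P : ControlProblem n m}

theorem IsELSolution.hasDerivWithinAt {h : ℝ} {c : ℝ → Phase n} (H : P.IsELSolution h c) {t : ℝ}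
    (ht : t ∈ Icc 0 h) : HasDerivWithinAt c (derivWithin (fun s => (c s).1) (Icc 0 h) t,
      derivWithin (fun s => (c s).2) (Icc 0 h) t) (Icc 0 h) t :=
  (H.contDiff_q.differentiableOn (by norm_num) t ht).hasDerivWithinAt.prodMk
    (H.contDiff_l.differentiableOn (by norm_num) t ht).hasDerivWithinAt

variable (P)

/-- The velocity of `q` along the solution segment. -/
def segmentVel (W : Set (Phase n × Phase n)) (h : ℝ) (y₀ y₁ : Phase n) (t : ℝ) : Coord n :=
  derivWithin (fun s => (P.segment W h y₀ y₁ s).1) (Icc 0 h) t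

/-- The momentum conjugate to `q` along the solution segment. -/
def segmentMom (W : Set (Phase n × Phase n)) (h : ℝ) (y₀ y₁ : Phase n) (t : ℝ) : Coord n :=
  derivWithin (fun s => (P.segment W h y₀ y₁ s).2) (Icc 0 h) t
    + P.dfvT (P.segment W h y₀ y₁ t).1 (P.segmentVel W h y₀ y₁ t) (P.segment W h y₀ y₁ t).2

variable {P} {W : Set (Phase n × Phase n)} {h : ℝ} {y₀ y₁ : Phase n}

theorem isExactSegment_segment (H : ∃ c, P.IsExactSegment W h y₀ y₁ c) :
    P.IsExactSegment W h y₀ y₁ (P.segment W h y₀ y₁) := by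
  rw [segment, dif_pos H]
  exact H.choose_spec

theorem InExactDomain.isExactSegment (H : P.InExactDomain W h y₀ y₁) :
    P.IsExactSegment W h y₀ y₁ (P.segment W h y₀ y₁) := by
  obtain ⟨U, -, hmem, hU, -⟩ := H
  obtain ⟨c, hc, -⟩ := hU _ hmem
  exact isExactSegment_segment ⟨c, hc⟩

theorem InExactDomain.eqOn_segment (H : P.InExactDomain W h y₀ y₁) {c : ℝ → Phase n}
    (hc : P.IsExactSegment W h y₀ y₁ c) : EqOn (P.segment W h y₀ y₁) c (Icc 0 h) := by
  have hs := H.isExactSegment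
  obtain ⟨U, -, hmem, hU, -⟩ := H
  obtain ⟨c', -, hc'⟩ := hU _ hmem
  exact (hc' _ hs).trans (hc' _ hc).symm

/-- The same open set serves all nearby pairs. Identities valid on the domain therefore hold near
(y₀, y₁) and may be differentiated there. -/
theorem InExactDomain.eventually (H : P.InExactDomain W h y₀ y₁) :
    ∀ᶠ z in nhds (y₀, y₁), P.InExactDomain W h z.1 z.2 := by
  obtain ⟨U, hUo, hmem, hU, hC⟩ := H
  filter_upwards [hUo.mem_nhds hmem] with z hz using ⟨U, hUo, hz, hU, hC⟩

theorem InExactDomain.isELFlow (hh : 0 < h) (H : P.InExactDomain W h y₀ y₁) :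
    P.IsELFlow (Icc 0 h) (fun t => (P.segment W h y₀ y₁ t).1) (fun t => (P.segment W h y₀ y₁ t).2)
      (P.segmentVel W h y₀ y₁) (P.segmentMom W h y₀ y₁) :=
  H.isExactSegment.solves.isELFlow hh

theorem InExactDomain.derivWithin_segment (hh : 0 < h) (H : P.InExactDomain W h y₀ y₁) {t : ℝ}
    (ht : t ∈ Icc 0 h) : derivWithin (P.segment W h y₀ y₁) (Icc 0 h) t =
      (P.segmentVel W h y₀ y₁ t, derivWithin (fun s => (P.segment W h y₀ y₁ s).2) (Icc 0 h) t) :=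
  (H.isExactSegment.solves.hasDerivWithinAt ht).derivWithin (uniqueDiffOn_Icc hh t ht)

/-- The velocity at a fixed time is a `C¹` function of the endpoints. -/
theorem InExactDomain.contDiffAt_segmentVel (hh : 0 < h) (H : P.InExactDomain W h y₀ y₁) {t : ℝ}
    (ht : t ∈ Icc 0 h) :
    ContDiffAt ℝ 1 (fun z : Phase n × Phase n => P.segmentVel W h z.1 z.2 t) (y₀, y₁) := by
  have hev := H.eventually
  obtain ⟨U, hUo, hmem, hU, hC⟩ := H
  have h1 : ContDiffOn ℝ 1 (fun z : Phase n × Phase n =>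
      (derivWithin (P.segment W h z.1 z.2) (Icc 0 h) t).1) U :=
    (hC.comp (f := fun z : Phase n × Phase n => (z, t)) (by fun_prop)
      fun z hz => ⟨hz, ht⟩).snd.fst
  refine (h1.contDiffAt (hUo.mem_nhds hmem)).congr_of_eventuallyEq ?_
  filter_upwards [hev] with z hz
  rw [hz.derivWithin_segment hh ht]

/-- Variation of the endpoints of the solution segment. -/
theorem InExactDomain.exists_variation (hh : 0 < h) (H : P.InExactDomain W h y₀ y₁) :
    ∃ A B : ℝ → (Phase n × Phase n) →L[ℝ] Phase n,
      (∀ t ∈ Icc 0 h, HasFDerivAt (fun z : Phase n × Phase n => P.segment W h z.1 z.2 t) (A t)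
        (y₀, y₁)) ∧
      (∀ t ∈ Icc 0 h, HasFDerivAt (fun z : Phase n × Phase n =>
        derivWithin (P.segment W h z.1 z.2) (Icc 0 h) t) (B t) (y₀, y₁)) ∧
      (∀ t ∈ Icc 0 h, HasDerivWithinAt A (B t) (Icc 0 h) t) ∧
      A 0 = ContinuousLinearMap.fst ℝ (Phase n) (Phase n) ∧
      A h = ContinuousLinearMap.snd ℝ (Phase n) (Phase n) := by
  have hev := H.eventually
  obtain ⟨U, hUo, hmem, hU, hC⟩ := H
  have h0 : (0 : ℝ) ∈ Icc 0 h := ⟨le_rfl, hh.le⟩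
  have h1 : h ∈ Icc 0 h := ⟨hh.le, le_rfl⟩
  obtain ⟨D, hDc, hD, hDi⟩ := hC.snd.exists_partial_deriv_integral hUo hh
  have hDc' : ContinuousOn (fun s => D ((y₀, y₁), s)) (Icc 0 h) :=
    hDc.comp (by fun_prop) fun s hs => ⟨hmem, hs⟩
  -- The segment is y₀ plus the integral of its velocity; differentiating under the integral
  -- exhibits A as a primitive of B. Time and endpoint derivatives thus commute with only joint C¹
  -- dependence of position and velocity.
  have hA : ∀ t ∈ Icc 0 h, HasFDerivAt (fun z : Phase n × Phase n => P.segment W h z.1 z.2 t)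
      (ContinuousLinearMap.fst ℝ (Phase n) (Phase n) + ∫ s in (0 : ℝ)..t, D ((y₀, y₁), s))
      (y₀, y₁) := by
    intro t ht
    refine (hasFDerivAt_fst.add (hDi _ hmem t ht)).congr_of_eventuallyEq ?_
    filter_upwards [hev, hUo.mem_nhds hmem] with z hz hzU
    have hsub : Icc 0 t ⊆ Icc 0 h := Icc_subset_Icc le_rfl ht.2
    have hs := hz.isExactSegment
    have := integral_eq_sub_of_hasDerivWithinAt_Icc ht.1
      (f := P.segment W h z.1 z.2) (f' := derivWithin (P.segment W h z.1 z.2) (Icc 0 h))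
      (fun s hs' => ((hs.solves.hasDerivWithinAt
        (hsub hs')).differentiableWithinAt.hasDerivWithinAt).mono hsub)
      ((hC.snd.continuousOn.comp (f := fun s : ℝ => (z, s)) (by fun_prop)
        fun s hs => ⟨hzU, hs⟩).mono hsub)
    show _ = z.1 + ∫ s in (0 : ℝ)..t, derivWithin (P.segment W h z.1 z.2) (Icc 0 h) s
    rw [this, hs.left]
    abel
  refine ⟨_, fun s => D ((y₀, y₁), s), hA, fun t ht => hD _ hmem t ht, fun t ht => ?_, ?_, ?_⟩
  · exact (hasDerivWithinAt_integral_Icc hDc' ht).const_add _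
  · simp
  -- The map from endpoints to the position at time h is the second projection near (y₀, y₁), so the
  -- derivatives agree.
  · refine (hA h h1).unique (hasFDerivAt_snd.congr_of_eventuallyEq ?_)
    filter_upwards [hev] with z hz using hz.isExactSegment.right

/-- The derivative of the exact discrete Lagrangian is given by the boundary momenta of the
solution segment. -/
theorem InExactDomain.hasFDerivAt_exactLd (hh : 0 < h) (H : P.InExactDomain W h y₀ y₁) :
    HasFDerivAt (fun z : Phase n × Phase n => P.exactLd W h z.1 z.2)
      (((innerSL ℝ (P.segmentMom W h y₀ y₁ h)).coprod (innerSL ℝ (P.segmentVel W h y₀ y₁ h))).comp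
          (ContinuousLinearMap.snd ℝ (Phase n) (Phase n))
        - ((innerSL ℝ (P.segmentMom W h y₀ y₁ 0)).coprod
            (innerSL ℝ (P.segmentVel W h y₀ y₁ 0))).comp
          (ContinuousLinearMap.fst ℝ (Phase n) (Phase n))) (y₀, y₁) := by
  have hF := H.isELFlow hh
  obtain ⟨A, B, hA, hB, hAB, hA0, hA1⟩ := H.exists_variation hh
  have H' := H
  obtain ⟨U, hUo, hmem, hU, hC⟩ := H'
  have h1 : h ∈ Icc 0 h := ⟨hh.le, le_rfl⟩
  have hL := P.lagrangian_contDiffOn.comp hC fun z hz =>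
    (isExactSegment_segment ((hU z.1 hz.1).imp fun c hc => hc.1)).solves.mem_Q z.2 hz.2
  obtain ⟨D, hDc, hD, hDi⟩ := hL.exists_partial_deriv_integral hUo hh
  have hDc' : ContinuousOn (fun s => D ((y₀, y₁), s)) (Icc 0 h) :=
    hDc.comp (by fun_prop) fun s hs => ⟨hmem, hs⟩
  refine (hDi _ hmem h h1).congr_fderiv ?_
  -- The abstract parameter derivative of the integrand is identified by the chain rule, using
  -- uniqueness of derivatives.
  have hDe : ∀ t ∈ Icc 0 h, D ((y₀, y₁), t) =
      (fderiv ℝ (fun z : Phase n × Phase n => P.lagrangian z.1 z.2)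
        (P.segment W h y₀ y₁ t, derivWithin (P.segment W h y₀ y₁) (Icc 0 h) t)).comp
        ((A t).prod (B t)) := by
    intro t ht
    have hLd : HasFDerivAt (fun z : Phase n × Phase n => P.lagrangian z.1 z.2) _
        (P.segment W h y₀ y₁ t, derivWithin (P.segment W h y₀ y₁) (Icc 0 h) t) :=
      ((P.lagrangian_contDiffOn.contDiffAt (P.isOpen_lagrangianDomain.mem_nhds
        (hF.mem_Q t ht))).differentiableAt one_ne_zero).hasFDerivAt
    exact (hD _ hmem t ht).unique (HasFDerivAt.comp (f := fun z : Phase n × Phase n =>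
      (P.segment W h z.1 z.2 t, derivWithin (P.segment W h z.1 z.2) (Icc 0 h) t)) (y₀, y₁)
      hLd ((hA t ht).prodMk (hB t ht)))
  refine ContinuousLinearMap.ext fun ζ => ?_
  have hint : IntervalIntegrable (fun s => D ((y₀, y₁), s)) MeasureTheory.volume 0 h := by
    rw [← uIcc_of_le hh.le] at hDc'
    exact hDc'.intervalIntegrable
  rw [ContinuousLinearMap.intervalIntegral_apply hint]
  -- Integration by parts in differential form: by the Euler-Lagrange equations the varied integrand
  -- is the time derivative of p·δq + q̇·δλ, so the integral is a difference of boundary terms.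
  have key : ∀ t ∈ Icc 0 h, HasDerivWithinAt
      (fun t => (inner ℝ (P.segmentMom W h y₀ y₁ t) (A t ζ).1 : ℝ)
        + inner ℝ (P.segmentVel W h y₀ y₁ t) (A t ζ).2) (D ((y₀, y₁), t) ζ) (Icc 0 h) t := by
    intro t ht
    have hAt : HasDerivWithinAt (fun t => A t ζ) (B t ζ) (Icc 0 h) t := by
      simpa using (hAB t ht).clm_apply (hasDerivWithinAt_const t (Icc 0 h) ζ)
    have hA1 : HasDerivWithinAt (fun t => (A t ζ).1) (B t ζ).1 (Icc 0 h) t :=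
      (ContinuousLinearMap.fst ℝ (Coord n) (Coord n)).hasFDerivAt.comp_hasDerivWithinAt t hAt
    have hA2 : HasDerivWithinAt (fun t => (A t ζ).2) (B t ζ).2 (Icc 0 h) t :=
      (ContinuousLinearMap.snd ℝ (Coord n) (Coord n)).hasFDerivAt.comp_hasDerivWithinAt t hAt
    refine (((hF.deriv_p t ht).inner ℝ hA1).add ((hF.deriv_v t ht).inner ℝ hA2)).congr_deriv ?_
    rw [hDe t ht, H.derivWithin_segment hh ht]
    show _ = fderiv ℝ (fun z : Phase n × Phase n => P.lagrangian z.1 z.2) _ (A t ζ, B t ζ)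
    rw [P.fderiv_lagrangian_apply (hF.mem_Q t ht)]
    show _ = inner ℝ (P.segmentMom W h y₀ y₁ t) _ + _ + _ + _
    ring
  rw [integral_eq_sub_of_hasDerivWithinAt_Icc hh.le key
    (hDc'.clm_apply continuousOn_const), hA0, hA1]
  simp

/-- The velocity of λ enters L̃ only through v_λᵀv, so the momentum conjugate to λ is q̇ itself. -/
theorem InExactDomain.vMinus_eq (hh : 0 < h) (H : P.InExactDomain W h y₀ y₁) :
    P.vMinus W h y₀ y₁ = P.segmentVel W h y₀ y₁ 0 := by
  have h1 := HasFDerivAt.comp (f := fun l => ((y₀.1, l), y₁)) y₀.2 (H.hasFDerivAt_exactLd hh)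
    ((hasFDerivAt_prodMk_right y₀.1 y₀.2).prodMk (hasFDerivAt_const y₁ y₀.2))
  refine ext_inner_right ℝ fun v => ?_
  rw [vMinus, inner_neg_left, inner_gradient_left]
  erw [h1.fderiv]
  simp

theorem InExactDomain.vPlus_eq (hh : 0 < h) (H : P.InExactDomain W h y₀ y₁) :
    P.vPlus W h y₀ y₁ = P.segmentVel W h y₀ y₁ h := by
  have h1 := HasFDerivAt.comp (f := fun l => (y₀, (y₁.1, l))) y₁.2 (H.hasFDerivAt_exactLd hh)
    ((hasFDerivAt_const y₀ y₁.2).prodMk (hasFDerivAt_prodMk_right y₁.1 y₁.2))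
  refine ext_inner_right ℝ fun v => ?_
  rw [vPlus, inner_gradient_left]
  erw [h1.fderiv]
  simp

/-- Being a gradient of L_d, `vMinus` would seem to need second derivatives of L_d; but near the
pair it equals the initial velocity of the segment, which is C¹ in the endpoints. -/
theorem InExactDomain.hasFDerivAt_vMinus (hh : 0 < h) (H : P.InExactDomain W h y₀ y₁) :
    HasFDerivAt (fun z : Phase n × Phase n => P.vMinus W h z.1 z.2)
      (fderiv ℝ (fun z : Phase n × Phase n => P.vMinus W h z.1 z.2) (y₀, y₁)) (y₀, y₁) := by
  refine (((H.contDiffAt_segmentVel hh ⟨le_rfl, hh.le⟩).differentiableAt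
    one_ne_zero).congr_of_eventuallyEq ?_).hasFDerivAt
  filter_upwards [H.eventually] with z hz using hz.vMinus_eq hh

theorem InExactDomain.hasFDerivAt_vPlus (hh : 0 < h) (H : P.InExactDomain W h y₀ y₁) :
    HasFDerivAt (fun z : Phase n × Phase n => P.vPlus W h z.1 z.2)
      (fderiv ℝ (fun z : Phase n × Phase n => P.vPlus W h z.1 z.2) (y₀, y₁)) (y₀, y₁) := by
  refine (((H.contDiffAt_segmentVel hh ⟨hh.le, le_rfl⟩).differentiableAt
    one_ne_zero).congr_of_eventuallyEq ?_).hasFDerivAt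
  filter_upwards [H.eventually] with z hz using hz.vPlus_eq hh

end ControlProblem

/-! ### Partial derivatives as restrictions of total ones. -/

section Partial

variable {X Y E : Type*} [NormedAddCommGroup X] [NormedSpace ℝ X] [NormedAddCommGroup Y]
  [NormedSpace ℝ Y] [NormedAddCommGroup E] [NormedSpace ℝ E] {F : X → Y → E}
  {F' : X × Y →L[ℝ] E} {x : X} {y : Y}

theorem HasFDerivAt.uncurry_left (hF : HasFDerivAt (fun z : X × Y => F z.1 z.2) F' (x, y)) :
    HasFDerivAt (fun x' => F x' y) (F'.comp (ContinuousLinearMap.inl ℝ X Y)) x :=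
  HasFDerivAt.comp (f := fun x' => (x', y)) x hF (hasFDerivAt_prodMk_left x y)

theorem HasFDerivAt.uncurry_right (hF : HasFDerivAt (fun z : X × Y => F z.1 z.2) F' (x, y)) :
    HasFDerivAt (fun y' => F x y') (F'.comp (ContinuousLinearMap.inr ℝ X Y)) y :=
  HasFDerivAt.comp (f := fun y' => (x, y')) y hF (hasFDerivAt_prodMk_right x y)

end Partial

section PhasePartial

variable {n : ℕ} {E : Type*} [NormedAddCommGroup E] [NormedSpace ℝ E] {F : Phase n → E}
  {F' : Phase n →L[ℝ] E} {y : Phase n}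

theorem HasFDerivAt.fderiv_position (hF : HasFDerivAt F F' y) :
    fderiv ℝ (fun q => F (q, y.2)) y.1 = F'.comp (ContinuousLinearMap.inl ℝ _ _) :=
  (HasFDerivAt.uncurry_left (F := fun q l => F (q, l)) hF).fderiv

theorem HasFDerivAt.fderiv_costate (hF : HasFDerivAt F F' y) :
    fderiv ℝ (fun l => F (y.1, l)) y.2 = F'.comp (ContinuousLinearMap.inr ℝ _ _) :=
  (HasFDerivAt.uncurry_right (F := fun q l => F (q, l)) hF).fderiv

end PhasePartial

/-! ### From the discrete conditions to matching of segments. -/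

namespace ControlProblem

variable {n m : ℕ} {P : ControlProblem n m} {W : Set (Phase n × Phase n)} {h : ℝ}
  {q0 v0 : Coord n} {N : ℕ} {yd : Fin (N + 1) → Phase n} {μ ν : Coord n}

theorem innerSL_injective : Function.Injective (innerSL ℝ : Coord n → Coord n →L[ℝ] ℝ) :=
  fun x y hxy => ext_inner_right ℝ fun v => by simpa using congrArg (fun f => f v) hxy

theorem endCovector_eq : P.endCovector W h yd = innerSL ℝ
    (P.gradPhiV (node yd N).1 (P.vPlus W h (node yd (N - 1)) (node yd N)) + (node yd N).2) := by
  ext v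
  rw [innerSL_apply_apply, inner_add_left, gradPhiV, inner_gradient_left]
  rfl

theorem endCovector_eq_zero_iff : P.endCovector W h yd = 0 ↔ (node yd N).2 =
    -P.gradPhiV (node yd N).1 (P.vPlus W h (node yd (N - 1)) (node yd N)) := by
  rw [endCovector_eq, ← map_zero (innerSL ℝ), innerSL_injective.eq_iff, eq_neg_iff_add_eq_zero,
    add_comm]

/-- No differentiability is needed: `gradient` is the Riesz dual of `fderiv`, default value
included. With its counterpart at the right end this makes the last two terms of the δλ conditions
cancel. -/
theorem fderiv_exactLd_costate_left (y₀ y₁ : Phase n) :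
    fderiv ℝ (fun l => P.exactLd W h (y₀.1, l) y₁) y₀.2 = -innerSL ℝ (P.vMinus W h y₀ y₁) := by
  ext v
  simp [vMinus]

theorem fderiv_exactLd_costate_right (y₀ y₁ : Phase n) :
    fderiv ℝ (fun l => P.exactLd W h y₀ (y₁.1, l)) y₁.2 = innerSL ℝ (P.vPlus W h y₀ y₁) := by
  ext v
  simp [vPlus]

theorem IsDiscreteOptimalSubst.isDiscreteOptimal
    (H : P.IsDiscreteOptimalSubst W h q0 v0 yd μ ν) : P.IsDiscreteOptimal W h q0 v0 yd μ ν where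
  toDiscreteConditions := H.toDiscreteConditions
  delta_l_zero := by
    rw [H.subst_zero, fderiv_exactLd_costate_left]
    simp
  delta_l_last := by
    rw [endCovector_eq_zero_iff.2 H.subst_last, fderiv_exactLd_costate_right]
    simp

theorem surjective_of_rank_eq {A : Coord n →L[ℝ] Coord n}
    (hA : (A : Coord n →ₗ[ℝ] Coord n).rank = n) : Function.Surjective A := by
  have h1 : Module.finrank ℝ (LinearMap.range (A : Coord n →ₗ[ℝ] Coord n)) = n :=
    Module.finrank_eq_of_rank_eq hA
  have h2 := Submodule.eq_top_of_finrank_eq (h1.trans finrank_euclideanSpace_fin.symm)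
  exact LinearMap.range_eq_top.1 h2

theorem comp_eq_zero_of_surjective {A : Coord n →L[ℝ] Coord n} (hA : Function.Surjective A)
    {L : Coord n →L[ℝ] ℝ} (hL : L.comp A = 0) : L = 0 := by
  ext v
  obtain ⟨w, rfl⟩ := hA v
  exact congrArg (fun f => f w) hL

/-- After the cancellation a covector composed with a surjective map is zero, so the covector is
zero. -/
theorem IsDiscreteOptimal.subst (H : P.IsDiscreteOptimal W h q0 v0 yd μ ν)
    (hr : P.FullRank W h yd) : P.IsDiscreteOptimalSubst W h q0 v0 yd μ ν where
  toDiscreteConditions := H.toDiscreteConditions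
  subst_zero := by
    have h1 := H.delta_l_zero
    rw [fderiv_exactLd_costate_left, sub_neg_eq_add, sub_add_cancel] at h1
    have h2 := comp_eq_zero_of_surjective (surjective_of_rank_eq hr.1) h1
    rw [← map_zero (innerSL ℝ), innerSL_injective.eq_iff] at h2
    exact sub_eq_zero.1 h2
  subst_last := by
    have h1 := H.delta_l_last
    rw [fderiv_exactLd_costate_right, add_sub_cancel_right] at h1
    exact endCovector_eq_zero_iff.1
      (comp_eq_zero_of_surjective (surjective_of_rank_eq hr.2) h1)

theorem InExactDomain.fderiv_exactLd_left (hh : 0 < h) {y₀ y₁ : Phase n}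
    (H : P.InExactDomain W h y₀ y₁) : fderiv ℝ (fun y => P.exactLd W h y y₁) y₀ =
      -(innerSL ℝ (P.segmentMom W h y₀ y₁ 0)).coprod (innerSL ℝ (P.segmentVel W h y₀ y₁ 0)) := by
  rw [(H.hasFDerivAt_exactLd hh).uncurry_left.fderiv]
  ext v <;> simp

theorem InExactDomain.fderiv_exactLd_right (hh : 0 < h) {y₀ y₁ : Phase n}
    (H : P.InExactDomain W h y₀ y₁) : fderiv ℝ (fun y => P.exactLd W h y₀ y) y₁ =
      (innerSL ℝ (P.segmentMom W h y₀ y₁ h)).coprod (innerSL ℝ (P.segmentVel W h y₀ y₁ h)) := by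
  rw [(H.hasFDerivAt_exactLd hh).uncurry_right.fderiv]
  ext v <;> simp

theorem InExactDomain.fderiv_exactLd_position_left (hh : 0 < h) {y₀ y₁ : Phase n}
    (H : P.InExactDomain W h y₀ y₁) : fderiv ℝ (fun q => P.exactLd W h (q, y₀.2) y₁) y₀.1 =
      -innerSL ℝ (P.segmentMom W h y₀ y₁ 0) := by
  rw [(H.hasFDerivAt_exactLd hh).uncurry_left.fderiv_position]
  ext v; simp

theorem InExactDomain.fderiv_exactLd_position_right (hh : 0 < h) {y₀ y₁ : Phase n}
    (H : P.InExactDomain W h y₀ y₁) : fderiv ℝ (fun q => P.exactLd W h y₀ (q, y₁.2)) y₁.1 =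
      innerSL ℝ (P.segmentMom W h y₀ y₁ h) := by
  rw [(H.hasFDerivAt_exactLd hh).uncurry_right.fderiv_position]
  ext v; simp

/-- In terms of the solution segments, the discrete conditions with the transversality conditions
substituted say that position, costate, velocity and momentum match at the inner nodes and satisfy
the boundary conditions at the ends. -/
structure SegmentsMatch (P : ControlProblem n m) (W : Set (Phase n × Phase n)) (h : ℝ)
    (q0 v0 : Coord n) {N : ℕ} (yd : Fin (N + 1) → Phase n) (μ ν : Coord n) : Prop where
  initial_q : (node yd 0).1 = q0
  initial_v : P.segmentVel W h (node yd 0) (node yd 1) 0 = v0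
  initial_mom : μ = -P.segmentMom W h (node yd 0) (node yd 1) 0
  initial_l : ν = (node yd 0).2
  final_l : (node yd N).2 = -P.gradPhiV (node yd N).1
    (P.segmentVel W h (node yd (N - 1)) (node yd N) h)
  final_mom : P.segmentMom W h (node yd (N - 1)) (node yd N) h = P.gradPhiQ (node yd N).1
    (P.segmentVel W h (node yd (N - 1)) (node yd N) h)
  match_mom : ∀ k, 1 ≤ k → k ≤ N - 1 → P.segmentMom W h (node yd (k - 1)) (node yd k) h =
    P.segmentMom W h (node yd k) (node yd (k + 1)) 0
  match_vel : ∀ k, 1 ≤ k → k ≤ N - 1 → P.segmentVel W h (node yd (k - 1)) (node yd k) h =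
    P.segmentVel W h (node yd k) (node yd (k + 1)) 0

/-- The transversality conditions annihilate both factors multiplying derivatives of v^∓. What
remains involves only first derivatives of L_d and φ, and those of L_d are boundary momenta. -/
theorem isDiscreteOptimalSubst_iff (hh : 0 < h) (hN : 2 ≤ N)
    (hyd : P.NodesInExactDomain W h yd) :
    P.IsDiscreteOptimalSubst W h q0 v0 yd μ ν ↔ P.SegmentsMatch W h q0 v0 yd μ ν := by
  have D0 : P.InExactDomain W h (node yd 0) (node yd 1) := hyd 0 (by omega)
  have DN : P.InExactDomain W h (node yd (N - 1)) (node yd N) := by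
    have := hyd (N - 1) (by omega)
    rwa [show N - 1 + 1 = N by omega] at this
  have Dk : ∀ k, 1 ≤ k → k ≤ N - 1 → P.InExactDomain W h (node yd (k - 1)) (node yd k) :=
    fun k h1 h2 => by
      have := hyd (k - 1) (by omega)
      rwa [show k - 1 + 1 = k by omega] at this
  have hdy : ν = (node yd 0).2 → P.endCovector W h yd = 0 → ∀ k, 1 ≤ k → k ≤ N - 1 →
      (((if k = 1 then (innerSL ℝ (ν - (node yd 0).2)).comp
        (fderiv ℝ (fun z => P.vMinus W h (node yd 0) z) (node yd 1)) else 0)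
      + (if k = N - 1 then (P.endCovector W h yd).comp
        (fderiv ℝ (fun z => P.vPlus W h z (node yd N)) (node yd (N - 1))) else 0)
      - (fderiv ℝ (fun z => P.exactLd W h (node yd (k - 1)) z) (node yd k)
        + fderiv ℝ (fun z => P.exactLd W h z (node yd (k + 1))) (node yd k)) = 0) ↔
      (P.segmentMom W h (node yd (k - 1)) (node yd k) h =
        P.segmentMom W h (node yd k) (node yd (k + 1)) 0 ∧
      P.segmentVel W h (node yd (k - 1)) (node yd k) h =
        P.segmentVel W h (node yd k) (node yd (k + 1)) 0)) := by
    intro hν hE k h1 h2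
    rw [hν, hE, (Dk k h1 h2).fderiv_exactLd_right hh,
      (hyd k (by omega)).fderiv_exactLd_left hh]
    simp only [sub_self, map_zero, ContinuousLinearMap.zero_comp, ite_self, add_zero, zero_sub,
      neg_eq_zero, ← sub_eq_add_neg, sub_eq_zero]
    constructor
    · intro he
      -- Test vectors (v, 0) and (0, v) separate the momentum from the velocity.
      constructor <;> refine ext_inner_right ℝ fun v => ?_
      · simpa using congrArg (fun f => f (v, 0)) he
      · simpa using congrArg (fun f => f (0, v)) he
    · rintro ⟨e1, e2⟩
      rw [e1, e2]
  have hq0 : ν = (node yd 0).2 → (((innerSL ℝ (ν - (node yd 0).2)).comp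
        (fderiv ℝ (fun q => P.vMinus W h (q, (node yd 0).2) (node yd 1)) (node yd 0).1)
      + innerSL ℝ μ
      - fderiv ℝ (fun q => P.exactLd W h (q, (node yd 0).2) (node yd 1)) (node yd 0).1 = 0) ↔
      μ = -P.segmentMom W h (node yd 0) (node yd 1) 0) := by
    intro hν
    rw [hν, D0.fderiv_exactLd_position_left hh, sub_self, map_zero,
      ContinuousLinearMap.zero_comp, zero_add, sub_eq_zero, ← map_neg, innerSL_injective.eq_iff]
  have hqN : P.endCovector W h yd = 0 → ((P.endCovector W h yd).comp
        (fderiv ℝ (fun q => P.vPlus W h (node yd (N - 1)) (q, (node yd N).2)) (node yd N).1)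
      + fderiv ℝ (fun q => P.φ q (P.vPlus W h (node yd (N - 1)) (node yd N))) (node yd N).1
      - fderiv ℝ (fun q => P.exactLd W h (node yd (N - 1)) (q, (node yd N).2)) (node yd N).1 = 0 ↔
      P.segmentMom W h (node yd (N - 1)) (node yd N) h = P.gradPhiQ (node yd N).1
        (P.segmentVel W h (node yd (N - 1)) (node yd N) h)) := by
    intro hE
    have e : fderiv ℝ (fun q => P.φ q (P.vPlus W h (node yd (N - 1)) (node yd N))) (node yd N).1 =
        innerSL ℝ (P.gradPhiQ (node yd N).1 (P.vPlus W h (node yd (N - 1)) (node yd N))) := by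
      ext v
      simp [gradPhiQ]
    rw [hE, e, DN.fderiv_exactLd_position_right hh, ContinuousLinearMap.zero_comp, zero_add,
      sub_eq_zero, innerSL_injective.eq_iff, DN.vPlus_eq hh, eq_comm]
  constructor
  · intro H
    have hE := endCovector_eq_zero_iff.2 H.subst_last
    exact
    { initial_q := H.delta_mu
      initial_v := by rw [← D0.vMinus_eq hh]; exact H.delta_nu
      initial_mom := (hq0 H.subst_zero).1 H.delta_q_zero
      initial_l := H.subst_zero
      final_l := by rw [← DN.vPlus_eq hh]; exact H.subst_last
      final_mom := (hqN hE).1 H.delta_q_last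
      match_mom := fun k h1 h2 => ((hdy H.subst_zero hE k h1 h2).1 (H.delta_y k h1 h2)).1
      match_vel := fun k h1 h2 => ((hdy H.subst_zero hE k h1 h2).1 (H.delta_y k h1 h2)).2 }
  · intro H
    have hl := H.final_l
    rw [← DN.vPlus_eq hh] at hl
    have hE := endCovector_eq_zero_iff.2 hl
    exact
    { delta_mu := H.initial_q
      delta_nu := by rw [D0.vMinus_eq hh]; exact H.initial_v
      delta_q_zero := (hq0 H.initial_l).2 H.initial_mom
      subst_zero := H.initial_l
      subst_last := hl
      delta_q_last := (hqN hE).2 H.final_mom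
      delta_y := fun k h1 h2 =>
        (hdy H.initial_l hE k h1 h2).2 ⟨H.match_mom k h1 h2, H.match_vel k h1 h2⟩ }

end ControlProblem

/-! ### Stationarity of the discrete objective. -/

namespace ControlProblem

/-- The bounds matter: `Fin.ofNat` reduces indices modulo N + 1. -/
theorem node_single {n N : ℕ} {k j : ℕ} (hk : k ≤ N) (hj : j ≤ N) (w : Phase n) :
    node (Pi.single (Fin.ofNat (N + 1) k) w) j = if j = k then w else 0 := by
  have : Fin.ofNat (N + 1) j = Fin.ofNat (N + 1) k ↔ j = k := by
    rw [Fin.ext_iff, Fin.val_ofNat, Fin.val_ofNat, Nat.mod_eq_of_lt (by omega),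
      Nat.mod_eq_of_lt (by omega)]
  simp only [node, Pi.single_apply, this]

/-- A variation of one node is seen by at most two summands: its own, through the first slot, and
the preceding one, through the second. -/
theorem sum_node_single {n N : ℕ} {k : ℕ} (hk : k ≤ N) (w : Phase n)
    (L : ℕ → Phase n × Phase n →L[ℝ] ℝ) :
    ∑ j ∈ Finset.range N, L j (node (Pi.single (Fin.ofNat (N + 1) k) w) j,
        node (Pi.single (Fin.ofNat (N + 1) k) w) (j + 1)) =
      (if k < N then L k (w, 0) else 0) + if 0 < k then L (k - 1) (0, w) else 0 := by
  have h1 : ∀ j ∈ Finset.range N, L j (node (Pi.single (Fin.ofNat (N + 1) k) w) j,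
        node (Pi.single (Fin.ofNat (N + 1) k) w) (j + 1)) =
      (if j = k then L j (w, 0) else 0) + if j + 1 = k then L j (0, w) else 0 := by
    intro j hj
    rw [Finset.mem_range] at hj
    rw [node_single hk hj.le, node_single hk hj]
    by_cases e1 : j = k
    · simp [e1]
    · by_cases e2 : j + 1 = k <;> simp [e1, e2, ← Prod.zero_eq_mk]
  rw [Finset.sum_congr rfl h1, Finset.sum_add_distrib, Finset.sum_ite_eq']
  congr 1
  · simp
  · rcases k with _ | i
    · simp
    · simp only [Nat.add_right_cancel_iff, Finset.sum_ite_eq', Finset.mem_range]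
      simp [show i < N by omega]

variable {n m : ℕ} {P : ControlProblem n m} {W : Set (Phase n × Phase n)} {h : ℝ}
  {q0 v0 : Coord n} {N : ℕ} {yd : Fin (N + 1) → Phase n} {μ ν : Coord n}

/-- The terms νᵀv₀ and -λ₀ᵀv₀ combine to the factor ν - λ₀, and φ and λ_Nᵀv_N to the factor D₂φ +
λ_Nᵀ. -/
theorem exists_hasFDerivAt_discreteObjective (hh : 0 < h) (hN : 2 ≤ N)
    (hyd : P.NodesInExactDomain W h yd) :
    ∃ J : ((Fin (N + 1) → Phase n) × Coord n × Coord n) →L[ℝ] ℝ,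
      HasFDerivAt (fun z : (Fin (N + 1) → Phase n) × Coord n × Coord n =>
        P.discreteObjective W h q0 v0 z.1 z.2.1 z.2.2) J (yd, μ, ν) ∧
      ∀ δ α β, J (δ, α, β) =
        P.endCovector W h yd (fderiv ℝ (fun z : Phase n × Phase n => P.vPlus W h z.1 z.2)
          (node yd (N - 1), node yd N) (node δ (N - 1), node δ N))
        + fderiv ℝ (fun q => P.φ q (P.vPlus W h (node yd (N - 1)) (node yd N))) (node yd N).1
          (node δ N).1
        + inner ℝ (P.vPlus W h (node yd (N - 1)) (node yd N)) (node δ N).2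
        + inner ℝ (ν - (node yd 0).2) (fderiv ℝ (fun z : Phase n × Phase n =>
          P.vMinus W h z.1 z.2) (node yd 0, node yd 1) (node δ 0, node δ 1))
        + inner ℝ μ (node δ 0).1
        - inner ℝ (P.vMinus W h (node yd 0) (node yd 1)) (node δ 0).2
        + inner ℝ ((node yd 0).1 - q0) α
        + inner ℝ (P.vMinus W h (node yd 0) (node yd 1) - v0) β
        - ∑ k ∈ Finset.range N, fderiv ℝ (fun z : Phase n × Phase n => P.exactLd W h z.1 z.2)
          (node yd k, node yd (k + 1)) (node δ k, node δ (k + 1)) := by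
  have D0 : P.InExactDomain W h (node yd 0) (node yd 1) := hyd 0 (by omega)
  have DN : P.InExactDomain W h (node yd (N - 1)) (node yd N) := by
    have := hyd (N - 1) (by omega)
    rwa [show N - 1 + 1 = N by omega] at this
  -- φ is regular only over Q; q_N lies there as the endpoint of a solution segment.
  have hQ : (node yd N).1 ∈ P.Q := by
    have := DN.isExactSegment.solves.mem_Q h ⟨hh.le, le_rfl⟩
    rwa [DN.isExactSegment.right] at this
  set x₀ : (Fin (N + 1) → Phase n) × Coord n × Coord n := (yd, μ, ν) with hx₀
  have hnode : ∀ k, HasFDerivAt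
      (fun z : (Fin (N + 1) → Phase n) × Coord n × Coord n => node z.1 k)
      ((ContinuousLinearMap.proj (R := ℝ) (φ := fun _ : Fin (N + 1) => Phase n)
        (Fin.ofNat (N + 1) k)).comp (ContinuousLinearMap.fst ℝ _ (Coord n × Coord n))) x₀ :=
    fun k => ((ContinuousLinearMap.proj (R := ℝ) (φ := fun _ : Fin (N + 1) => Phase n)
      (Fin.ofNat (N + 1) k)).comp (ContinuousLinearMap.fst ℝ _ (Coord n × Coord n))).hasFDerivAt
  have hμ : HasFDerivAt (fun z : (Fin (N + 1) → Phase n) × Coord n × Coord n => z.2.1)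
      ((ContinuousLinearMap.fst ℝ (Coord n) (Coord n)).comp
        (ContinuousLinearMap.snd ℝ (Fin (N + 1) → Phase n) (Coord n × Coord n))) x₀ :=
    ((ContinuousLinearMap.fst ℝ (Coord n) (Coord n)).comp
      (ContinuousLinearMap.snd ℝ (Fin (N + 1) → Phase n) (Coord n × Coord n))).hasFDerivAt
  have hν : HasFDerivAt (fun z : (Fin (N + 1) → Phase n) × Coord n × Coord n => z.2.2)
      ((ContinuousLinearMap.snd ℝ (Coord n) (Coord n)).comp
        (ContinuousLinearMap.snd ℝ (Fin (N + 1) → Phase n) (Coord n × Coord n))) x₀ :=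
    ((ContinuousLinearMap.snd ℝ (Coord n) (Coord n)).comp
      (ContinuousLinearMap.snd ℝ (Fin (N + 1) → Phase n) (Coord n × Coord n))).hasFDerivAt
  have hq : ∀ k, HasFDerivAt
      (fun z : (Fin (N + 1) → Phase n) × Coord n × Coord n => (node z.1 k).1) _ x₀ :=
    fun k => (ContinuousLinearMap.fst ℝ (Coord n) (Coord n)).hasFDerivAt.comp x₀ (hnode k)
  have hl : ∀ k, HasFDerivAt
      (fun z : (Fin (N + 1) → Phase n) × Coord n × Coord n => (node z.1 k).2) _ x₀ :=
    fun k => (ContinuousLinearMap.snd ℝ (Coord n) (Coord n)).hasFDerivAt.comp x₀ (hnode k)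
  have hp : HasFDerivAt (fun z : (Fin (N + 1) → Phase n) × Coord n × Coord n =>
      P.vPlus W h (node z.1 (N - 1)) (node z.1 N)) _ x₀ :=
    HasFDerivAt.comp (f := fun z : (Fin (N + 1) → Phase n) × Coord n × Coord n =>
      (node z.1 (N - 1), node z.1 N)) x₀ (DN.hasFDerivAt_vPlus hh) ((hnode _).prodMk (hnode _))
  have hm : HasFDerivAt (fun z : (Fin (N + 1) → Phase n) × Coord n × Coord n =>
      P.vMinus W h (node z.1 0) (node z.1 1)) _ x₀ :=
    HasFDerivAt.comp (f := fun z : (Fin (N + 1) → Phase n) × Coord n × Coord n =>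
      (node z.1 0, node z.1 1)) x₀ (D0.hasFDerivAt_vMinus hh) ((hnode _).prodMk (hnode _))
  have hL : ∀ k ∈ Finset.range N, HasFDerivAt
      (fun z : (Fin (N + 1) → Phase n) × Coord n × Coord n =>
        P.exactLd W h (node z.1 k) (node z.1 (k + 1))) _ x₀ := fun k hk =>
    HasFDerivAt.comp (f := fun z : (Fin (N + 1) → Phase n) × Coord n × Coord n =>
      (node z.1 k, node z.1 (k + 1))) x₀
      ((hyd k (Finset.mem_range.1 hk)).hasFDerivAt_exactLd
        hh).differentiableAt.hasFDerivAt ((hnode _).prodMk (hnode _))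
  have hmem : ((node yd N).1, P.vPlus W h (node yd (N - 1)) (node yd N)) ∈
      P.Q ×ˢ (univ : Set (Coord n)) := ⟨hQ, mem_univ _⟩
  have hφ0 : HasFDerivAt (fun z : Coord n × Coord n => P.φ z.1 z.2) _
      ((node yd N).1, P.vPlus W h (node yd (N - 1)) (node yd N)) :=
    ((P.φ_contDiffOn.contDiffAt ((P.isOpen_Q.prod isOpen_univ).mem_nhds hmem)).differentiableAt one_ne_zero).hasFDerivAt
  have hφ := HasFDerivAt.comp (f := fun z : (Fin (N + 1) → Phase n) × Coord n × Coord n =>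
      ((node z.1 N).1, P.vPlus W h (node z.1 (N - 1)) (node z.1 N))) x₀ hφ0 ((hq N).prodMk hp)
  have htot := ((((hφ.add (hμ.inner ℝ ((hq 0).sub_const q0))).add
    (hν.inner ℝ (hm.sub_const v0))).add ((hl N).inner ℝ hp)).sub ((hl 0).inner ℝ hm)).sub
    (HasFDerivAt.fun_sum hL)
  refine ⟨_, htot, fun δ α β => ?_⟩
  have hnδ : ∀ k, δ (Fin.ofNat (N + 1) k) = node δ k := fun _ => rfl
  have hφs : ∀ a b : Coord n, fderiv ℝ (fun z : Coord n × Coord n => P.φ z.1 z.2)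
      ((node yd N).1, P.vPlus W h (node yd (N - 1)) (node yd N)) (a, b) =
      fderiv ℝ (fun q => P.φ q (P.vPlus W h (node yd (N - 1)) (node yd N))) (node yd N).1 a
      + fderiv ℝ (fun v => P.φ (node yd N).1 v) (P.vPlus W h (node yd (N - 1)) (node yd N)) b := by
    intro a b
    rw [hφ0.uncurry_left.fderiv, hφ0.uncurry_right.fderiv]
    simp only [ContinuousLinearMap.comp_apply, ← map_add]
    simp
  simp only [add_apply, sub_apply,
    ContinuousLinearMap.comp_apply, ContinuousLinearMap.prod_apply, sum_apply,
    fderivInnerCLM_apply, ContinuousLinearMap.proj_apply, ContinuousLinearMap.coe_fst',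
    ContinuousLinearMap.coe_snd', hnδ, hφs, endCovector, innerSL_apply_apply, hx₀,
    inner_sub_left, real_inner_comm _ α, real_inner_comm _ β]
  rw [real_inner_comm _ (node δ N).2, real_inner_comm _ (node δ 0).2]
  ring

/-- Variations supported at a single node, together with those of μ and ν, span all variations; on
each of them the derivative is one condition of the list, or the δq and δλ conditions together at
the end nodes. -/
theorem isDiscreteOptimal_iff_stationary (hh : 0 < h) (hN : 2 ≤ N)
    (hyd : P.NodesInExactDomain W h yd) :
    HasFDerivAt (fun z : (Fin (N + 1) → Phase n) × Coord n × Coord n =>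
        P.discreteObjective W h q0 v0 z.1 z.2.1 z.2.2)
      (0 : ((Fin (N + 1) → Phase n) × Coord n × Coord n) →L[ℝ] ℝ) (yd, μ, ν) ↔
    P.IsDiscreteOptimal W h q0 v0 yd μ ν := by
  have D0 : P.InExactDomain W h (node yd 0) (node yd 1) := hyd 0 (by omega)
  have DN : P.InExactDomain W h (node yd (N - 1)) (node yd N) := by
    have := hyd (N - 1) (by omega)
    rwa [show N - 1 + 1 = N by omega] at this
  have Dk : ∀ k, 1 ≤ k → k ≤ N → P.InExactDomain W h (node yd (k - 1)) (node yd k) :=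
    fun k h1 h2 => by
      have := hyd (k - 1) (by omega)
      rwa [show k - 1 + 1 = k by omega] at this
  have dL : ∀ {a b : Phase n}, P.InExactDomain W h a b → HasFDerivAt
      (fun z : Phase n × Phase n => P.exactLd W h z.1 z.2)
      (fderiv ℝ (fun z : Phase n × Phase n => P.exactLd W h z.1 z.2) (a, b)) (a, b) :=
    fun H => (H.hasFDerivAt_exactLd hh).differentiableAt.hasFDerivAt
  obtain ⟨J, hJ, hJe⟩ := exists_hasFDerivAt_discreteObjective (q0 := q0) (v0 := v0) (μ := μ)
    (ν := ν) hh hN hyd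
  have hsum := fun (k : ℕ) (hk : k ≤ N) (w : Phase n) => sum_node_single hk w fun k =>
    fderiv ℝ (fun z : Phase n × Phase n => P.exactLd W h z.1 z.2) (node yd k, node yd (k + 1))
  have J0 : ∀ w, J (Pi.single (Fin.ofNat (N + 1) 0) w, 0, 0) =
      inner ℝ (ν - (node yd 0).2) (fderiv ℝ (fun z : Phase n × Phase n =>
          P.vMinus W h z.1 z.2) (node yd 0, node yd 1) (w, 0))
        + inner ℝ μ w.1 - inner ℝ (P.vMinus W h (node yd 0) (node yd 1)) w.2
        - fderiv ℝ (fun z : Phase n × Phase n => P.exactLd W h z.1 z.2)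
          (node yd 0, node yd 1) (w, 0) := by
    intro w
    -- N ≥ 2 separates node 0 from node N - 1, so v_N^{e,+} does not see y₀; likewise v₀^{e,-} does
    -- not see y_N below.
    rw [hJe, hsum 0 (by omega), node_single (by omega) (by omega), node_single (by omega) le_rfl,
      node_single (by omega) (by omega), node_single (by omega) (by omega),
      if_neg (by omega), if_neg (by omega), if_pos rfl, if_neg one_ne_zero, if_pos (by omega),
      if_neg (by omega)]
    simp [← Prod.zero_eq_mk]
  have JN : ∀ w, J (Pi.single (Fin.ofNat (N + 1) N) w, 0, 0) =
      P.endCovector W h yd (fderiv ℝ (fun z : Phase n × Phase n => P.vPlus W h z.1 z.2)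
          (node yd (N - 1), node yd N) (0, w))
        + fderiv ℝ (fun q => P.φ q (P.vPlus W h (node yd (N - 1)) (node yd N))) (node yd N).1 w.1
        + inner ℝ (P.vPlus W h (node yd (N - 1)) (node yd N)) w.2
        - fderiv ℝ (fun z : Phase n × Phase n => P.exactLd W h z.1 z.2)
          (node yd (N - 1), node yd N) (0, w) := by
    intro w
    rw [hJe, hsum N le_rfl, node_single le_rfl (by omega), node_single le_rfl le_rfl,
      node_single le_rfl (by omega), node_single le_rfl (by omega),
      if_neg (by omega), if_pos rfl, if_neg (by omega), if_neg (by omega), if_neg (by omega),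
      if_pos (by omega), show N - 1 + 1 = N by omega]
    simp [← Prod.zero_eq_mk]
  have Jk : ∀ k, 1 ≤ k → k ≤ N - 1 → ∀ w, J (Pi.single (Fin.ofNat (N + 1) k) w, 0, 0) =
      (if k = 1 then inner ℝ (ν - (node yd 0).2) (fderiv ℝ (fun z : Phase n × Phase n =>
          P.vMinus W h z.1 z.2) (node yd 0, node yd 1) (0, w)) else 0)
      + (if k = N - 1 then P.endCovector W h yd (fderiv ℝ (fun z : Phase n × Phase n =>
          P.vPlus W h z.1 z.2) (node yd (N - 1), node yd N) (w, 0)) else 0)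
      - (fderiv ℝ (fun z : Phase n × Phase n => P.exactLd W h z.1 z.2)
          (node yd (k - 1), node yd k) (0, w)
        + fderiv ℝ (fun z : Phase n × Phase n => P.exactLd W h z.1 z.2)
          (node yd k, node yd (k + 1)) (w, 0)) := by
    intro k h1 h2 w
    rw [hJe, hsum k (by omega), node_single (by omega) (by omega),
      node_single (by omega) le_rfl, node_single (by omega) (by omega),
      node_single (by omega) (by omega), if_neg (show ¬ N = k by omega),
      if_neg (show ¬ 0 = k by omega), if_pos (show k < N by omega), if_pos (show 0 < k by omega),
      show k - 1 + 1 = k by omega]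
    -- For N = 2 the only inner node carries both extra terms, so the two conditionals are kept
    -- independent.
    simp only [show N - 1 = k ↔ k = N - 1 from eq_comm, show 1 = k ↔ k = 1 from eq_comm]
    split_ifs <;> simp [← Prod.zero_eq_mk] <;> ring
  have Jμ : ∀ α, J (0, α, 0) = inner ℝ ((node yd 0).1 - q0) α := by
    intro α
    rw [hJe]
    simp [show ∀ k, node (0 : Fin (N + 1) → Phase n) k = 0 from fun _ => rfl, ← Prod.zero_eq_mk]
  have Jν : ∀ β, J (0, 0, β) = inner ℝ (P.vMinus W h (node yd 0) (node yd 1) - v0) β := by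
    intro β
    rw [hJe]
    simp [show ∀ k, node (0 : Fin (N + 1) → Phase n) k = 0 from fun _ => rfl, ← Prod.zero_eq_mk]
  have hJ0 : HasFDerivAt (fun z : (Fin (N + 1) → Phase n) × Coord n × Coord n =>
        P.discreteObjective W h q0 v0 z.1 z.2.1 z.2.2)
      (0 : ((Fin (N + 1) → Phase n) × Coord n × Coord n) →L[ℝ] ℝ) (yd, μ, ν) ↔ J = 0 :=
    ⟨fun H => hJ.unique H, fun H => H ▸ hJ⟩
  have hJsplit : ∀ k w, J (Pi.single (Fin.ofNat (N + 1) k) w, 0, 0) =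
      J (Pi.single (Fin.ofNat (N + 1) k) (w.1, 0), 0, 0)
        + J (Pi.single (Fin.ofNat (N + 1) k) (0, w.2), 0, 0) := by
    intro k w
    rw [← map_add, Prod.mk_add_mk, ← Pi.single_add]
    simp
  rw [hJ0]
  constructor
  · intro hz
    simp only [hz, zero_apply] at J0 JN Jk Jμ Jν
    exact
    { delta_q_zero := by
        rw [(D0.hasFDerivAt_vMinus hh).uncurry_left.fderiv_position,
          (dL D0).uncurry_left.fderiv_position]
        ext x
        simpa [inner_sub_left] using (J0 (x, 0)).symm
      delta_l_zero := by
        rw [dVMinus, (D0.hasFDerivAt_vMinus hh).uncurry_left.fderiv_costate,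
          (dL D0).uncurry_left.fderiv_costate]
        ext x
        simpa [inner_sub_left] using (J0 (0, x)).symm
      delta_y := fun k h1 h2 => by
        rw [(dL (Dk k h1 (by omega))).uncurry_right.fderiv,
          (dL (hyd k (by omega))).uncurry_left.fderiv,
          (D0.hasFDerivAt_vMinus hh).uncurry_right.fderiv,
          (DN.hasFDerivAt_vPlus hh).uncurry_left.fderiv]
        refine ContinuousLinearMap.ext fun w => Eq.trans ?_ (Jk k h1 h2 w).symm
        split_ifs <;> simp [inner_sub_left]
      delta_q_last := by
        rw [(DN.hasFDerivAt_vPlus hh).uncurry_right.fderiv_position,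
          (dL DN).uncurry_right.fderiv_position]
        ext x
        simpa [inner_sub_left] using (JN (x, 0)).symm
      delta_l_last := by
        rw [dVPlus, (DN.hasFDerivAt_vPlus hh).uncurry_right.fderiv_costate,
          (dL DN).uncurry_right.fderiv_costate]
        ext x
        simpa [inner_sub_left] using (JN (0, x)).symm
      delta_mu := sub_eq_zero.1 (ext_inner_right ℝ fun α => by rw [← Jμ, inner_zero_left])
      delta_nu := sub_eq_zero.1 (ext_inner_right ℝ fun β => by rw [← Jν, inner_zero_left]) }
  · intro H
    have hk : ∀ k ≤ N, ∀ w, J (Pi.single (Fin.ofNat (N + 1) k) w, 0, 0) = 0 := by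
      intro k hk w
      rcases Nat.eq_zero_or_pos k with rfl | hpos
      · have e1 := H.delta_q_zero
        have e2 := H.delta_l_zero
        rw [(D0.hasFDerivAt_vMinus hh).uncurry_left.fderiv_position,
          (dL D0).uncurry_left.fderiv_position] at e1
        rw [dVMinus, (D0.hasFDerivAt_vMinus hh).uncurry_left.fderiv_costate,
          (dL D0).uncurry_left.fderiv_costate] at e2
        have e1' := congrArg (fun f => f w.1) e1
        have e2' := congrArg (fun f => f w.2) e2
        simp only [add_apply, sub_apply,
          ContinuousLinearMap.comp_apply, innerSL_apply_apply, ContinuousLinearMap.inl_apply,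
          ContinuousLinearMap.inr_apply, zero_apply] at e1' e2'
        rw [hJsplit, J0, J0]
        simp only [inner_zero_right]
        linarith
      rcases hk.eq_or_lt with rfl | hlt
      · have e1 := H.delta_q_last
        have e2 := H.delta_l_last
        rw [(DN.hasFDerivAt_vPlus hh).uncurry_right.fderiv_position,
          (dL DN).uncurry_right.fderiv_position] at e1
        rw [dVPlus, (DN.hasFDerivAt_vPlus hh).uncurry_right.fderiv_costate,
          (dL DN).uncurry_right.fderiv_costate] at e2
        have e1' := congrArg (fun f => f w.1) e1
        have e2' := congrArg (fun f => f w.2) e2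
        simp only [add_apply, sub_apply,
          ContinuousLinearMap.comp_apply, innerSL_apply_apply, ContinuousLinearMap.inl_apply,
          ContinuousLinearMap.inr_apply, zero_apply] at e1' e2'
        rw [hJsplit, JN, JN]
        simp only [inner_zero_right, map_zero]
        linarith
      · have e1 := H.delta_y k hpos (by omega)
        rw [(dL (Dk k hpos (by omega))).uncurry_right.fderiv,
          (dL (hyd k (by omega))).uncurry_left.fderiv,
          (D0.hasFDerivAt_vMinus hh).uncurry_right.fderiv,
          (DN.hasFDerivAt_vPlus hh).uncurry_left.fderiv] at e1
        rw [Jk k hpos (by omega)]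
        refine Eq.trans ?_ (congrArg (fun f => f w) e1)
        split_ifs <;> simp [inner_sub_left]
    have hα : ∀ α, J (0, α, 0) = 0 := fun α => by
      rw [Jμ, H.delta_mu, sub_self, inner_zero_left]
    have hβ : ∀ β, J (0, 0, β) = 0 := fun β => by
      rw [Jν, H.delta_nu, sub_self, inner_zero_left]
    have hδ : (J : (Fin (N + 1) → Phase n) × Coord n × Coord n →ₗ[ℝ] ℝ).comp (LinearMap.inl ℝ (Fin (N + 1) → Phase n) _) = 0 := by
      refine LinearMap.pi_ext fun i w => ?_
      have := hk i (by omega) w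
      rwa [show Fin.ofNat (N + 1) (i : ℕ) = i from Fin.cast_val_eq_self i] at this
    ext z
    · exact congrArg (fun f => f z) hδ
    · exact hα z
    · exact hβ z

end ControlProblem

/-! ### Concatenation of curves on consecutive intervals. -/

section Concatenate

variable {E : Type*} {h : ℝ} {N : ℕ} {X : ℕ → ℝ → E}

/-- Concatenation of the curves `X k` on `[0, h]`, `k < N`, to a curve on `[0, N h]`. -/
def concatenate (h : ℝ) (N : ℕ) (X : ℕ → ℝ → E) (t : ℝ) : E :=
  X (min ⌊t / h⌋₊ (N - 1)) (t - ((min ⌊t / h⌋₊ (N - 1) : ℕ) : ℝ) * h)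

theorem concatenate_eqOn (hh : 0 < h) (hX : ∀ k, 1 ≤ k → k ≤ N - 1 → X (k - 1) h = X k 0) {k : ℕ}
    (hk : k < N) :
    EqOn (concatenate h N X) (fun t => X k (t + -(k * h))) (Icc (k * h) ((k + 1) * h)) := by
  intro t ht
  have h1 : (k : ℝ) ≤ t / h := (le_div_iff₀ hh).2 ht.1
  rcases ht.2.eq_or_lt with rfl | hlt
  -- At the right end the floor has already moved to k + 1: the matching hypothesis identifies the
  -- value with the end of piece k, and on the last piece the `min` holds the index at N - 1.
  · have e : ⌊((k : ℝ) + 1) * h / h⌋₊ = k + 1 := by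
      rw [mul_div_cancel_right₀ _ hh.ne']
      exact_mod_cast Nat.floor_natCast (R := ℝ) (k + 1)
    by_cases hkN : k + 1 ≤ N - 1
    · have e' := hX (k + 1) (by omega) hkN
      simp only [concatenate, e, min_eq_left hkN]
      rw [show ((k : ℝ) + 1) * h - ((k + 1 : ℕ) : ℝ) * h = 0 by push_cast; ring, ← e',
        Nat.add_sub_cancel]
      congr 1
      ring
    · simp only [concatenate, e, show min (k + 1) (N - 1) = k by omega, sub_eq_add_neg]
  · have e : ⌊t / h⌋₊ = k := by
      rw [Nat.floor_eq_iff (le_trans (Nat.cast_nonneg k) h1)]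
      exact ⟨h1, (div_lt_iff₀ hh).2 hlt⟩
    simp only [concatenate, e, show min k (N - 1) = k by omega, sub_eq_add_neg]

theorem concatenate_zero (hh : 0 < h) (hX : ∀ k, 1 ≤ k → k ≤ N - 1 → X (k - 1) h = X k 0)
    (hN : 0 < N) : concatenate h N X 0 = X 0 0 := by
  have := concatenate_eqOn hh hX hN (x := 0) ⟨by simp, by simpa using hh.le⟩
  simpa using this

theorem concatenate_last (hh : 0 < h) (hX : ∀ k, 1 ≤ k → k ≤ N - 1 → X (k - 1) h = X k 0)
    (hN : 0 < N) : concatenate h N X (N * h) = X (N - 1) h := by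
  have e : ((N - 1 : ℕ) : ℝ) = N - 1 := by
    rw [Nat.cast_sub (by omega), Nat.cast_one]
  have := concatenate_eqOn hh hX (k := N - 1) (by omega) (x := N * h)
    ⟨by rw [e]; nlinarith, by rw [e]; nlinarith⟩
  rw [this]
  simp only [e]
  congr 1
  ring

theorem exists_mem_Icc_consecutive (hh : 0 < h) (hN : 0 < N) {t : ℝ} (ht : t ∈ Icc 0 (N * h)) :
    ∃ k < N, t ∈ Icc (k * h) ((k + 1) * h) := by
  have h0 : 0 ≤ t / h := div_nonneg ht.1 hh.le
  by_cases hk : ⌊t / h⌋₊ < N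
  · exact ⟨_, hk, (le_div_iff₀ hh).1 (Nat.floor_le h0),
      ((div_lt_iff₀ hh).1 (Nat.lt_floor_add_one _)).le⟩
  · have h1 : (N : ℝ) ≤ t / h := (Nat.le_floor_iff h0).1 (not_lt.1 hk)
    have h2 := (le_div_iff₀ hh).1 h1
    have e : ((N - 1 : ℕ) : ℝ) = N - 1 := by
      rw [Nat.cast_sub (by omega), Nat.cast_one]
    refine ⟨N - 1, by omega, ?_, ?_⟩
    · rw [e]; nlinarith
    · rw [e]; nlinarith [ht.2]

end Concatenate

/-! ### Sampling continuous solutions and gluing discrete ones. -/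

namespace ControlProblem

variable {n m : ℕ} {P : ControlProblem n m} {W : Set (Phase n × Phase n)} {h T : ℝ}
  {q0 v0 : Coord n} {N : ℕ} {yd : Fin (N + 1) → Phase n} {μ ν : Coord n}

theorem node_sample {y : ℝ → Phase n} {k : ℕ} (hk : k ≤ N) :
    node (sample h N y) k = y (k * h) := by
  rw [node, sample, Fin.val_ofNat, Nat.mod_eq_of_lt (by omega)]

theorem IsELFlow.segmentVel_segmentMom_eq (hh : 0 < h) {y₀ y₁ : Phase n} {c : ℝ → Phase n}
    {v p : ℝ → Coord n}
    (H : P.IsELFlow (Icc 0 h) (fun t => (c t).1) (fun t => (c t).2) v p)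
    (hc : EqOn (P.segment W h y₀ y₁) c (Icc 0 h)) {t : ℝ} (ht : t ∈ Icc 0 h) :
    P.segmentVel W h y₀ y₁ t = v t ∧ P.segmentMom W h y₀ y₁ t = p t := by
  have hS := uniqueDiffOn_Icc hh t ht
  have e1 : P.segmentVel W h y₀ y₁ t = v t := by
    rw [segmentVel, derivWithin_congr (f := fun t => (c t).1)
      (fun s hs => by simp only [hc hs]) (by simp only [hc ht])]
    exact (H.deriv_q t ht).derivWithin hS
  refine ⟨e1, ?_⟩
  rw [segmentMom, e1, hc ht, derivWithin_congr (f := fun t => (c t).2)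
      (fun s hs => by simp only [hc hs]) (by simp only [hc ht]),
      (H.deriv_l t ht).derivWithin hS, sub_add_cancel]

/-- Shifted restrictions of y are exact segments, hence by uniqueness the chosen ones. Both sides of
a matching condition are then values of one function, v or p, at the same time. -/
theorem IsContinuousOptimal.segmentsMatch_sample (hh : 0 < h) (hN : 2 ≤ N)
    (hT : N * h = T) {y : ℝ → Phase n} {u : ℝ → Coord m}
    (H : P.IsContinuousOptimal T q0 v0 y u μ ν)
    (hW : ∀ t ∈ Icc 0 T, (y t, derivWithin y (Icc 0 T) t) ∈ W)
    (hyd : P.NodesInExactDomain W h (sample h N y)) :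
    P.SegmentsMatch W h q0 v0 (sample h N y) μ ν := by
  have hTpos : 0 < T := by
    rw [← hT]
    have : (0 : ℝ) < N := by exact_mod_cast (by omega : 0 < N)
    positivity
  have hEL := H.isELSolution
  have hF := hEL.isELFlow hTpos
  set v := derivWithin (fun t => (y t).1) (Icc 0 T) with hv
  set p := fun t => derivWithin (fun t => (y t).2) (Icc 0 T) t
    + P.dfvT (y t).1 (v t) (y t).2 with hp
  have hsub : ∀ k < N, Icc (0 + k * h) (h + k * h) ⊆ Icc 0 T := by
    intro k hk t ht
    have h1 : ((k : ℝ) + 1) ≤ N := by exact_mod_cast hk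
    have h2 : (0 : ℝ) ≤ k * h := by positivity
    exact ⟨by linarith [ht.1], by rw [← hT]; nlinarith [ht.2]⟩
  have hFk : ∀ k < N, P.IsELFlow (Icc 0 h) (fun t => (y (t + k * h)).1)
      (fun t => (y (t + k * h)).2) (fun t => v (t + k * h)) (fun t => p (t + k * h)) :=
    fun k hk => (hF.mono (hsub k hk)).comp_add_const
  have hseg : ∀ k < N, P.IsExactSegment W h (node (sample h N y) k) (node (sample h N y) (k + 1))
      (fun t => y (t + k * h)) := by
    intro k hk
    refine ⟨(hFk k hk).isELSolution hh, ?_, ?_, fun t ht => ?_⟩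
    · rw [node_sample hk.le, zero_add]
    · rw [node_sample hk]
      congr 1
      push_cast
      ring
    · have hm : t + k * h ∈ Icc (0 + k * h) (h + k * h) := ⟨by linarith [ht.1], by linarith [ht.2]⟩
      -- Membership in W is known for derivatives relative to [0, T] and required relative to [0,
      -- h]; the former restrict to the subinterval and shift.
      have hd := ((hEL.hasDerivWithinAt (hsub k hk hm)).mono (hsub k hk)).comp_add_const_Icc
      have := hW _ (hsub k hk hm)
      rw [(hEL.hasDerivWithinAt (hsub k hk hm)).derivWithin
        (uniqueDiffOn_Icc hTpos _ (hsub k hk hm))] at this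
      rwa [hd.derivWithin (uniqueDiffOn_Icc hh t ht)]
  have hval : ∀ k < N, ∀ t ∈ Icc 0 h,
      P.segmentVel W h (node (sample h N y) k) (node (sample h N y) (k + 1)) t = v (t + k * h) ∧
      P.segmentMom W h (node (sample h N y) k) (node (sample h N y) (k + 1)) t = p (t + k * h) :=
    fun k hk t ht => (hFk k hk).segmentVel_segmentMom_eq hh
      ((hyd k hk).eqOn_segment (hseg k hk)) ht
  have m0 : (0 : ℝ) ∈ Icc 0 h := ⟨le_rfl, hh.le⟩
  have m1 : h ∈ Icc 0 h := ⟨hh.le, le_rfl⟩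
  have hfirst := hval 0 (by omega) 0 m0
  have hlast := hval (N - 1) (by omega) h m1
  have eT : h + ((N - 1 : ℕ) : ℝ) * h = T := by
    rw [← hT, Nat.cast_sub (by omega)]
    push_cast
    ring
  have hmatch : ∀ k, 1 ≤ k → k ≤ N - 1 → h + ((k - 1 : ℕ) : ℝ) * h = 0 + k * h := by
    intro k h1 h2
    rw [Nat.cast_sub h1]
    push_cast
    ring
  have n0 : node (sample h N y) 0 = y 0 := by rw [node_sample (by omega)]; simp
  have nN : node (sample h N y) N = y T := by rw [node_sample le_rfl, hT]
  rw [show N - 1 + 1 = N by omega, eT] at hlast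
  simp only [Nat.cast_zero, zero_mul, add_zero, zero_add] at hfirst
  exact
  { initial_q := by rw [n0]; exact H.initial_q
    initial_v := by rw [hfirst.1]; exact H.initial_v
    initial_mom := by rw [hfirst.2, H.transversality_mu, hp, neg_add, ← sub_eq_add_neg]
    initial_l := by rw [n0]; exact H.transversality_nu
    final_l := by rw [hlast.1, nN]; exact H.transversality_l
    final_mom := by
      rw [hlast.1, hlast.2, nN, hp]
      simp only
      -- Substituting λ(T) = -(∂φ/∂q̇)ᵀ cancels the two terms with (∂f/∂q̇)ᵀ and leaves p(T) =
      -- (∂φ/∂q)ᵀ.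
      rw [H.transversality_dl, H.transversality_l, map_neg, add_neg_cancel_right]
    match_mom := fun k h1 h2 => by
      have ha := hval (k - 1) (by omega) h m1
      rw [show k - 1 + 1 = k by omega, hmatch k h1 h2] at ha
      rw [ha.2, (hval k (by omega) 0 m0).2]
    match_vel := fun k h1 h2 => by
      have ha := hval (k - 1) (by omega) h m1
      rw [show k - 1 + 1 = k by omega, hmatch k h1 h2] at ha
      rw [ha.1, (hval k (by omega) 0 m0).1] }

/-- Velocity and momentum are concatenated like the curve. Matching makes all four components
single-valued at the nodes, so the first-order system passes from the pieces to [0, T]. -/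
theorem SegmentsMatch.isContinuousOptimal_glue (hh : 0 < h) (hN : 2 ≤ N) (hT : N * h = T)
    (hyd : P.NodesInExactDomain W h yd) (H : P.SegmentsMatch W h q0 v0 yd μ ν) :
    P.IsContinuousOptimal T q0 v0 (P.glue W h yd)
      (fun t => P.optControl (P.glue W h yd t).1 (P.glue W h yd t).2) μ ν := by
  have hTpos : 0 < T := by
    rw [← hT]
    have : (0 : ℝ) < N := by exact_mod_cast (by omega : 0 < N)
    positivity
  have hN0 : 0 < N := by omega
  have eN : N - 1 + 1 = N := by omega
  have hX : ∀ k, 1 ≤ k → k ≤ N - 1 →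
      P.segment W h (node yd (k - 1)) (node yd (k - 1 + 1)) h =
        P.segment W h (node yd k) (node yd (k + 1)) 0 := fun k h1 h2 => by
    rw [(hyd (k - 1) (by omega)).isExactSegment.right, (hyd k (by omega)).isExactSegment.left,
      show k - 1 + 1 = k by omega]
  have hV : ∀ k, 1 ≤ k → k ≤ N - 1 →
      P.segmentVel W h (node yd (k - 1)) (node yd (k - 1 + 1)) h =
        P.segmentVel W h (node yd k) (node yd (k + 1)) 0 := fun k h1 h2 => by
    rw [show k - 1 + 1 = k by omega]; exact H.match_vel k h1 h2
  have hM : ∀ k, 1 ≤ k → k ≤ N - 1 →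
      P.segmentMom W h (node yd (k - 1)) (node yd (k - 1 + 1)) h =
        P.segmentMom W h (node yd k) (node yd (k + 1)) 0 := fun k h1 h2 => by
    rw [show k - 1 + 1 = k by omega]; exact H.match_mom k h1 h2
  set y := P.glue W h yd
  set v := concatenate h N fun k => P.segmentVel W h (node yd k) (node yd (k + 1))
  set p := concatenate h N fun k => P.segmentMom W h (node yd k) (node yd (k + 1))
  have hpiece : ∀ k < N, P.IsELFlow (Icc (k * h) ((k + 1) * h)) (fun t => (y t).1)
      (fun t => (y t).2) v p := by
    intro k hk
    have h1 : P.IsELFlow (Icc (k * h + -(k * h)) ((k + 1) * h + -(k * h)))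
        (fun t => (P.segment W h (node yd k) (node yd (k + 1)) t).1)
        (fun t => (P.segment W h (node yd k) (node yd (k + 1)) t).2)
        (P.segmentVel W h (node yd k) (node yd (k + 1)))
        (P.segmentMom W h (node yd k) (node yd (k + 1))) := by
      rw [show k * h + -(k * h) = 0 by ring, show (k + 1) * h + -(k * h) = h by ring]
      exact (hyd k hk).isELFlow hh
    -- `glue` is by definition the `concatenate` of the segments.
    have hy : EqOn y _ _ := concatenate_eqOn
      (X := fun k => P.segment W h (node yd k) (node yd (k + 1))) hh hX hk
    exact h1.comp_add_const.congr (fun t ht => by simp only [hy ht])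
      (fun t ht => by simp only [hy ht])
      (concatenate_eqOn (X := fun k => P.segmentVel W h (node yd k) (node yd (k + 1))) hh hV hk)
      (concatenate_eqOn (X := fun k => P.segmentMom W h (node yd k) (node yd (k + 1))) hh hM hk)
  have hF : P.IsELFlow (Icc 0 T) (fun t => (y t).1) (fun t => (y t).2) v p := by
    rw [← hT]
    refine IsELFlow.of_consecutive hh.le hN0.ne' hpiece fun t ht => ?_
    obtain ⟨k, hk, hkt⟩ := exists_mem_Icc_consecutive hh hN0 ht
    exact (hpiece k hk).mem_Q t hkt
  have y0 : y 0 = node yd 0 :=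
    (concatenate_zero (X := fun k => P.segment W h (node yd k) (node yd (k + 1))) hh hX hN0).trans
      (hyd 0 hN0).isExactSegment.left
  have vz : v 0 = P.segmentVel W h (node yd 0) (node yd 1) 0 :=
    concatenate_zero (X := fun k => P.segmentVel W h (node yd k) (node yd (k + 1))) hh hV hN0
  have pz : p 0 = P.segmentMom W h (node yd 0) (node yd 1) 0 :=
    concatenate_zero (X := fun k => P.segmentMom W h (node yd k) (node yd (k + 1))) hh hM hN0
  have yT : y T = node yd N := by
    have := (concatenate_last (X := fun k => P.segment W h (node yd k) (node yd (k + 1)))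
      hh hX hN0).trans (hyd (N - 1) (by omega)).isExactSegment.right
    rwa [hT, eN] at this
  have vT : v T = P.segmentVel W h (node yd (N - 1)) (node yd N) h := by
    have := concatenate_last (X := fun k => P.segmentVel W h (node yd k) (node yd (k + 1)))
      hh hV hN0
    rwa [hT, eN] at this
  have pT : p T = P.segmentMom W h (node yd (N - 1)) (node yd N) h := by
    have := concatenate_last (X := fun k => P.segmentMom W h (node yd k) (node yd (k + 1)))
      hh hM hN0
    rwa [hT, eN] at this
  have hS := uniqueDiffOn_Icc hTpos
  have m0 : (0 : ℝ) ∈ Icc 0 T := ⟨le_rfl, hTpos.le⟩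
  have m1 : T ∈ Icc 0 T := ⟨hTpos.le, le_rfl⟩
  have dq0 := (hF.deriv_q 0 m0).derivWithin (hS 0 m0)
  have dqT := (hF.deriv_q T m1).derivWithin (hS T m1)
  have dl0 := (hF.deriv_l 0 m0).derivWithin (hS 0 m0)
  have dlT := (hF.deriv_l T m1).derivWithin (hS T m1)
  refine (hF.isELSolution hTpos).isContinuousOptimal ?_ ?_ ?_ ?_ ?_ ?_
  · rw [y0]; exact H.initial_q
  · rw [dq0, vz]; exact H.initial_v
  · rw [dq0, dl0, H.initial_mom, pz]; abel
  · rw [y0]; exact H.initial_l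
  · rw [dqT, dlT, pT, H.final_mom, vT, yT, H.final_l, map_neg, sub_neg_eq_add]
  · rw [dqT, vT, yT]; exact H.final_l

end ControlProblem

end

theorem mainTheorem1 {n m : ℕ} (P : ControlProblem n m) (W : Set (Phase n × Phase n))
    (q0 v0 : Coord n) (T : ℝ) (hT : 0 < T) (N : ℕ) (hN : 2 ≤ N) :
    -- the discrete optimality conditions are the stationarity conditions of the objective
    (∀ (yd : Fin (N + 1) → Phase n) (μ ν : Coord n),
      P.NodesInExactDomain W (T / N) yd →
      (HasFDerivAt
          (fun z : (Fin (N + 1) → Phase n) × Coord n × Coord n =>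
            P.discreteObjective W (T / N) q0 v0 z.1 z.2.1 z.2.2)
          (0 : ((Fin (N + 1) → Phase n) × Coord n × Coord n) →L[ℝ] ℝ) (yd, μ, ν) ↔
        P.IsDiscreteOptimal W (T / N) q0 v0 yd μ ν)) ∧
    -- samplings of continuous optimal curves are discretely optimal
    (∀ (y : ℝ → Phase n) (u : ℝ → Coord m) (μ ν : Coord n),
      P.IsContinuousOptimal T q0 v0 y u μ ν →
      (∀ t ∈ Set.Icc 0 T, (y t, derivWithin y (Set.Icc 0 T) t) ∈ W) →
      P.NodesInExactDomain W (T / N) (ControlProblem.sample (T / N) N y) →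
      P.IsDiscreteOptimal W (T / N) q0 v0 (ControlProblem.sample (T / N) N y) μ ν ∧
        P.IsDiscreteOptimalSubst W (T / N) q0 v0 (ControlProblem.sample (T / N) N y) μ ν) ∧
    -- gluings of exact segments through discretely optimal nodes are continuously optimal
    (∀ (yd : Fin (N + 1) → Phase n) (μ ν : Coord n),
      P.NodesInExactDomain W (T / N) yd →
      ((P.FullRank W (T / N) yd ∧ P.IsDiscreteOptimal W (T / N) q0 v0 yd μ ν) ∨
        P.IsDiscreteOptimalSubst W (T / N) q0 v0 yd μ ν) →
      ∃ u : ℝ → Coord m,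
        P.IsContinuousOptimal T q0 v0 (P.glue W (T / N) yd) u μ ν) := by
  have hN0 : (0 : ℝ) < N := by exact_mod_cast (by omega : 0 < N)
  have hh : 0 < T / N := div_pos hT hN0
  have hNT : (N : ℝ) * (T / N) = T := mul_div_cancel₀ T hN0.ne'
  refine ⟨fun yd μ ν hyd => ControlProblem.isDiscreteOptimal_iff_stationary hh hN hyd,
    fun y u μ ν H hW hyd => ?_, fun yd μ ν hyd H => ?_⟩
  · have h1 := (ControlProblem.isDiscreteOptimalSubst_iff hh hN hyd).2
      (H.segmentsMatch_sample hh hN hNT hW hyd)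
    exact ⟨h1.isDiscreteOptimal, h1⟩
  · have h1 : P.IsDiscreteOptimalSubst W (T / N) q0 v0 yd μ ν :=
      H.elim (fun h => h.2.subst h.1) id
    exact ⟨_, ((ControlProblem.isDiscreteOptimalSubst_iff hh hN
      hyd).1 h1).isContinuousOptimal_glue hh hN hNT hyd⟩
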